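/- Let $M$ be a four-dimensional Riemannian manifold with boundary, described in a coordinate patch $x^\mu$ as $M=\{\rho\ge 0\}$ with $d\rho\neq0$ where $\rho=0$, and let $y^a\mapsto x^\mu(y)$ be local coordinates on $\partial M$. Let $e_\mu^\alpha$ be a smooth vierbein, $g_{\mu\nu}=\sum_\alpha e_\mu^\alpha e_\nu^\alpha$, $e^\mu_a=\partial x^\mu/\partial y^a$, $h_{ab}=g_{\mu\nu}e^\mu_ae^\nu_b$, $e^a_\mu=h^{ab}g_{\mu\nu}e^\nu_b$, $n^\mu$ the inward unit normal, $K_{ab}=-n_{\mu;\nu}e_a^\mu e_b^\nu$ and $K=h^{ab}K_{ab}$. Let $\gamma^\alpha$ be $4\times4$ matrices with $\{\gamma^\alpha,\gamma^\beta\}=-2\delta^{\alpha\beta}$, let $\gamma_F$ be an involution of a finite-dimensional space $V=\mathbb C^F$ (for instance $\gamma_F=1$), and put, on fields with values in $\mathbb C^4\otimes V$, $$\gamma^\mu=e^\mu_\alpha\gamma^\alpha\otimes\gamma_F,\qquad \gamma^n=\gamma_n=n_\mu\gamma^\mu,\qquad \gamma^a=e^a_\mu\gamma^\mu,\qquad \chi=-\tfrac{\sqrt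 h}{3!}\,\epsilon_{abc}\,e^a_\mu e^b_\nu e^c_\lambda\,e^\mu_\alpha e^\nu_\beta e^\lambda_\delta\,\gamma^\alpha\gamma^\beta\gamma^\delta\otimes 1$$ with $\epsilon_{123}=1$, and $\Pi_\pm=\frac12(1\pm\chi)$. Let $\nabla_\mu=\partial_\mu+\omega_\mu$, where $\omega_\mu=\frac14\omega_\mu{}^{\alpha\beta}\gamma_{\alpha\beta}\otimes1$, $\gamma_{\alpha\beta}=\frac12[\gamma_\alpha,\gamma_\beta]$, is the spin connection given by $\partial_\mu e_\nu^\alpha-\omega_\mu{}^{\alpha\beta}e_{\nu\beta}-\Gamma^\rho_{\mu\nu}e^\alpha_\rho=0$. Let $\Phi$ be a smooth matrix-valued function on $M$ and $D=\gamma^\mu\nabla_\mu-\Phi$. Then $\chi^2=1$ on $\partial M$, and $D^2=-(g^{\mu\nu}\partial_\mu\partial_\nu+\mathbb A^\mu\partial_\mu+\mathbb B)$ on smooth fields, with unique and smooth $\mathbb A^\mu,\mathbb B$. Put $\omega'_\mu=\frac12g_{\mu\nu}(\mathbb A^\nu+g^{\rho\sigma}\Gamma^\nu_{\rho\sigma})$,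 $\nabla'_\mu=\partial_\mu+\omega'_\mu$, $\theta_\mu=\omega'_\mu-\omega_\mu$, $\Phi'=\Phi+\gamma^\mu\theta_\mu$, $\nabla'_n=n^\mu\nabla'_\mu$, $\theta_a=e_a^\mu\theta_\mu$ and $\omega'_a=e_a^\mu\omega'_\mu$. For a matrix-valued function $\Xi$ let $$S_\Xi=\Pi_+\bigl(\gamma_n\Xi-\tfrac12\gamma_n\gamma^a\nabla'_a\chi\bigr)\Pi_+,\qquad \nabla'_a\chi=\partial_a\chi+[\omega'_a,\chi].$$ 1. $D=\gamma^\mu\nabla'_\mu-\Phi'$. 2. On $\partial M$, $\nabla'_a\chi=K_{ab}\,\chi\gamma^n\gamma^b+[\theta_a,\chi]$. 3. Each point of $\partial M$ has a neighbourhood in $M$ to which $\chi$ extends as a smooth field of involutions. Whatever such extension is used to form $\nabla'_n\Pi_+\Psi$ at each boundary point, every field $\Psi$ that is smooth up to the boundary satisfies the boundary condition of $D^2$, that is $\Pi_-\Psi|_{\partial M}=0$ and $\Pi_-D\Psi|_{\partial M}=0$, if and only if it satisfies the mixed Dirichlet/Robin condition $$\mathcal B_\chi\Psi=\Pi_-\Psi|_{\partial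 M}\oplus\Pi_+(\nabla'_n+S_{\Phi'})\Pi_+\Psi|_{\partial M}=0 .$$ 4. (Pure gravity.) If $\Phi=0$, then $\theta_\mu=0$ and $S_\Phi=S_{\Phi'}=-\frac12K\Pi_+$. 5. (Standard Model.) If $\Phi=-(\gamma^\mu(1\otimes B_\mu)+1\otimes H)$, that is $D=\gamma^\mu(\nabla_\mu+1\otimes B_\mu)+1\otimes H$, with $B_\mu$ commuting and $H$ anticommuting with $\gamma_F$, and if $B_n=n^\mu B_\mu=0$ on $\partial M$, then $\theta_\mu=1\otimes B_\mu$ and $S_\Phi=S_{\Phi'}=-\frac12K\Pi_+$. -/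

import Mathlib

open scoped Matrix Kronecker ContDiff

namespace DiracBoundary

noncomputable section

/-- The partial derivative `∂ᵢ f` at `x`, taken within the set `s` (so that it makes sense up to the
boundary of a domain). -/
def pd {k : ℕ} {W : Type*} [NormedAddCommGroup W] [NormedSpace ℝ W] (s : Set (Fin k → ℝ))
    (i : Fin k) (f : (Fin k → ℝ) → W) (x : Fin k → ℝ) : W :=
  fderivWithin ℝ f s x (Pi.single i 1)

/-- The entrywise partial derivative of a matrix-valued function. -/
def pdMat {k : ℕ} {ι : Type*} (s : Set (Fin k → ℝ)) (i : Fin k)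
    (A : (Fin k → ℝ) → Matrix ι ι ℂ) (x : Fin k → ℝ) : Matrix ι ι ℂ :=
  Matrix.of fun p q => pd s i (fun z => A z p q) x

/-- A matrix-valued function with smooth entries on `s` (up to the boundary). -/
def SmoothMat {k : ℕ} {ι W : Type*} [NormedAddCommGroup W] [NormedSpace ℝ W]
    (s : Set (Fin k → ℝ)) (A : (Fin k → ℝ) → Matrix ι ι W) : Prop :=
  ∀ p q, ContDiffOn ℝ ∞ (fun x => A x p q) s

/-- A coordinate patch of a four-dimensional Riemannian manifold with boundary, with an orthonormal
frame, a representation of the Clifford algebra on the spinor space `ℂ⁴`, and an internal space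
`ℂ^F` with an involution `γF` (`γF = 1` if there is no grading).  The spinor fields have values in
`ℂ⁴ ⊗ ℂ^F`. -/
structure DiracPatch (F : Type*) [Fintype F] [DecidableEq F] where
  /-- the coordinate domain; the manifold is `{x ∈ Ω | 0 ≤ ρ x}` -/
  Ω : Set (Fin 4 → ℝ)
  isOpen_Ω : IsOpen Ω
  /-- a defining function of the boundary hypersurface -/
  ρ : (Fin 4 → ℝ) → ℝ
  smooth_ρ : ContDiffOn ℝ ∞ ρ Ω
  regular_ρ : ∀ x ∈ Ω, ρ x = 0 → fderiv ℝ ρ x ≠ 0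
  /-- the domain of the coordinates `y` of the boundary -/
  V : Set (Fin 3 → ℝ)
  isOpen_V : IsOpen V
  /-- the embedding `y ↦ x(y)` of the hypersurface -/
  emb : (Fin 3 → ℝ) → (Fin 4 → ℝ)
  smooth_emb : ContDiffOn ℝ ∞ emb V
  emb_mem : ∀ y ∈ V, emb y ∈ Ω ∧ ρ (emb y) = 0
  injOn_emb : Set.InjOn emb V
  immersion_emb : ∀ y ∈ V, Function.Injective (fderiv ℝ emb y)
  /-- the vierbein: `e x μ α` is the component with curved index `μ` and flat index `α` -/
  e : (Fin 4 → ℝ) → Matrix (Fin 4) (Fin 4) ℝ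
  smooth_e : SmoothMat {x | x ∈ Ω ∧ 0 ≤ ρ x} e
  det_e : ∀ x ∈ Ω, 0 ≤ ρ x → (e x).det ≠ 0
  /-- the flat gamma matrices -/
  γ : Fin 4 → Matrix (Fin 4) (Fin 4) ℂ
  clifford : ∀ α β, γ α * γ β + γ β * γ α = if α = β then -2 else 0
  γF : Matrix F F ℂ
  γF_sq : γF * γF = 1

namespace DiracPatch

variable {F : Type*} [Fintype F] [DecidableEq F] (P : DiracPatch F)

/-- The manifold with boundary in the coordinate patch. -/
def M : Set (Fin 4 → ℝ) := {x | x ∈ P.Ω ∧ 0 ≤ P.ρ x}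

/-! Riemannian geometry of the patch. -/

/-- `g_{μν} = ∑_α e_μ^α e_ν^α`. -/
def g (x : Fin 4 → ℝ) : Matrix (Fin 4) (Fin 4) ℝ := P.e x * (P.e x)ᵀ

/-- `g^{μν}`. -/
def gInv (x : Fin 4 → ℝ) : Matrix (Fin 4) (Fin 4) ℝ := (P.g x)⁻¹

/-- The inverse vierbein `e^μ_α`. -/
def eInv (μ α : Fin 4) (x : Fin 4 → ℝ) : ℝ := (P.e x)⁻¹ α μ

/-- The Christoffel symbol `Γ^r_{μν}`. -/
def christoffel (r μ ν : Fin 4) (x : Fin 4 → ℝ) : ℝ :=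
  (1 / 2) * ∑ s, P.gInv x r s *
    (pd P.M μ (fun z => P.g z s ν) x + pd P.M ν (fun z => P.g z μ s) x
      - pd P.M s (fun z => P.g z μ ν) x)

/-- The coefficient `ω_μ^{αβ}` of the spin connection, that is, the solution of
`∂_μ e_ν^α - ω_μ^{αβ} e_{νβ} - Γ^r_{μν} e_r^α = 0`. -/
def spinCoeff (μ α β : Fin 4) (x : Fin 4 → ℝ) : ℝ :=
  ∑ ν, (pd P.M μ (fun z => P.e z ν α) x - ∑ r, P.christoffel r μ ν x * P.e x r α) * P.eInv ν β x

/-- The spin connection `ω_μ = (1/4) ω_μ^{αβ} γ_{αβ}`, `γ_{αβ} = (1/2) [γ_α, γ_β]`, acting on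
`ℂ⁴ ⊗ ℂ^F` through the first factor. -/
def spinConn (μ : Fin 4) (x : Fin 4 → ℝ) : Matrix (Fin 4 × F) (Fin 4 × F) ℂ :=
  ((1 / 4 : ℝ) • ∑ α, ∑ β,
    P.spinCoeff μ α β x • ((1 / 2 : ℝ) • (P.γ α * P.γ β - P.γ β * P.γ α))) ⊗ₖ (1 : Matrix F F ℂ)

/-- `e^μ_α γ^α` on the spinor space `ℂ⁴`. -/
def spinorGamma (μ : Fin 4) (x : Fin 4 → ℝ) : Matrix (Fin 4) (Fin 4) ℂ :=
  ∑ α, P.eInv μ α x • P.γ α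

/-- The gamma matrix `γ^μ` of the Dirac operator, `e^μ_α γ^α ⊗ γF` on `ℂ⁴ ⊗ ℂ^F`. -/
def gamma (μ : Fin 4) (x : Fin 4 → ℝ) : Matrix (Fin 4 × F) (Fin 4 × F) ℂ :=
  P.spinorGamma μ x ⊗ₖ P.γF

/-! Geometry of the boundary. -/

/-- The tangent vector `e_a^μ = ∂x^μ / ∂y^a`. -/
def tangent (a : Fin 3) (μ : Fin 4) (y : Fin 3 → ℝ) : ℝ := pd P.V a P.emb y μ

/-- The induced metric `h_{ab}`. -/
def h (y : Fin 3 → ℝ) : Matrix (Fin 3) (Fin 3) ℝ :=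
  Matrix.of fun a b => ∑ μ, ∑ ν, P.g (P.emb y) μ ν * P.tangent a μ y * P.tangent b ν y

/-- `h^{ab}`. -/
def hInv (y : Fin 3 → ℝ) : Matrix (Fin 3) (Fin 3) ℝ := (P.h y)⁻¹

/-- `∂_μ ρ` at the boundary point `x(y)`. -/
def dρ (μ : Fin 4) (y : Fin 3 → ℝ) : ℝ := pd P.Ω μ P.ρ (P.emb y)

/-- The inward unit normal `n^μ`, the normalized gradient of `ρ`. -/
def normal (μ : Fin 4) (y : Fin 3 → ℝ) : ℝ :=
  (∑ ν, P.gInv (P.emb y) μ ν * P.dρ ν y) /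
    Real.sqrt (∑ ν, ∑ r, P.gInv (P.emb y) ν r * P.dρ ν y * P.dρ r y)

/-- `n_μ = g_{μν} n^ν`. -/
def conormal (μ : Fin 4) (y : Fin 3 → ℝ) : ℝ := ∑ ν, P.g (P.emb y) μ ν * P.normal ν y

/-- `e^a_μ = h^{ab} g_{μν} e_b^ν`. -/
def cotangent (a : Fin 3) (μ : Fin 4) (y : Fin 3 → ℝ) : ℝ :=
  ∑ b, ∑ ν, P.hInv y a b * P.g (P.emb y) μ ν * P.tangent b ν y

/-- The extrinsic curvature `K_{ab} = - n_{μ;ν} e_a^μ e_b^ν`, where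
`n_{μ;ν} e_b^ν = ∂n_μ / ∂y^b - Γ^r_{μν} n_r e_b^ν`. -/
def K (a b : Fin 3) (y : Fin 3 → ℝ) : ℝ :=
  -∑ μ, (pd P.V b (P.conormal μ) y
      - ∑ ν, ∑ r, P.christoffel r μ ν (P.emb y) * P.conormal r y * P.tangent b ν y)
    * P.tangent a μ y

/-- The trace `K = h^{ab} K_{ab}`. -/
def trK (y : Fin 3 → ℝ) : ℝ := ∑ a, ∑ b, P.hInv y a b * P.K a b y

/-- `γ^n = γ^μ n_μ`, which is also `γ_n = γ_μ n^μ`. -/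
def gammaN (y : Fin 3 → ℝ) : Matrix (Fin 4 × F) (Fin 4 × F) ℂ :=
  ∑ μ, P.conormal μ y • P.gamma μ (P.emb y)

/-- `γ^a = γ^μ e^a_μ`. -/
def gammaT (a : Fin 3) (y : Fin 3 → ℝ) : Matrix (Fin 4 × F) (Fin 4 × F) ℂ :=
  ∑ μ, P.cotangent a μ y • P.gamma μ (P.emb y)

/-- `γ^a` on the spinor space `ℂ⁴`. -/
def spinorGammaT (a : Fin 3) (y : Fin 3 → ℝ) : Matrix (Fin 4) (Fin 4) ℂ :=
  ∑ μ, P.cotangent a μ y • P.spinorGamma μ (P.emb y)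

/-- `χ = - (√h / 3!) ε_{abc} γ^a γ^b γ^c`, acting on `ℂ⁴ ⊗ ℂ^F` through the first factor. -/
def χ (y : Fin 3 → ℝ) : Matrix (Fin 4 × F) (Fin 4 × F) ℂ :=
  (-(Real.sqrt (P.h y).det / 6) • ∑ σ : Equiv.Perm (Fin 3), ((Equiv.Perm.sign σ : ℤ) : ℝ) •
    (P.spinorGammaT (σ 0) y * P.spinorGammaT (σ 1) y * P.spinorGammaT (σ 2) y))
    ⊗ₖ (1 : Matrix F F ℂ)

/-- `Π_- = (1 - χ) / 2`. -/
def projM (y : Fin 3 → ℝ) : Matrix (Fin 4 × F) (Fin 4 × F) ℂ := (1 / 2 : ℝ) • (1 - P.χ y)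

/-- `Π_+ = 1 - Π_-`. -/
def projP (y : Fin 3 → ℝ) : Matrix (Fin 4 × F) (Fin 4 × F) ℂ := 1 - P.projM y

/-! Spinor fields, the Dirac operator and its square. -/

/-- Spinor fields that are smooth up to the boundary. -/
def SmoothSpinor (Ψ : (Fin 4 → ℝ) → (Fin 4 × F → ℂ)) : Prop := ContDiffOn ℝ ∞ Ψ P.M

/-- The covariant derivative `(∂_μ + A_μ) Ψ`. -/
def cov (A : Fin 4 → (Fin 4 → ℝ) → Matrix (Fin 4 × F) (Fin 4 × F) ℂ) (μ : Fin 4)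
    (Ψ : (Fin 4 → ℝ) → (Fin 4 × F → ℂ)) (x : Fin 4 → ℝ) : Fin 4 × F → ℂ :=
  pd P.M μ Ψ x + A μ x *ᵥ Ψ x

/-- The operator `γ^μ (∂_μ + A_μ) - Φ`. -/
def diracOp (A : Fin 4 → (Fin 4 → ℝ) → Matrix (Fin 4 × F) (Fin 4 × F) ℂ)
    (Φ : (Fin 4 → ℝ) → Matrix (Fin 4 × F) (Fin 4 × F) ℂ)
    (Ψ : (Fin 4 → ℝ) → (Fin 4 × F → ℂ)) (x : Fin 4 → ℝ) : Fin 4 × F → ℂ :=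
  (∑ μ, P.gamma μ x *ᵥ P.cov A μ Ψ x) - Φ x *ᵥ Ψ x

/-- The Dirac operator `D = γ^μ ∇_μ - Φ`, where `∇` is the spin connection. -/
def dirac (Φ : (Fin 4 → ℝ) → Matrix (Fin 4 × F) (Fin 4 × F) ℂ)
    (Ψ : (Fin 4 → ℝ) → (Fin 4 × F → ℂ)) : (Fin 4 → ℝ) → (Fin 4 × F → ℂ) :=
  P.diracOp P.spinConn Φ Ψ

/-- `D² = -(g^{μν} ∂_μ ∂_ν + A^μ ∂_μ + B)` for the Dirac operator `D = γ^μ ∇_μ - Φ`. -/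
def IsSquareForm (Φ : (Fin 4 → ℝ) → Matrix (Fin 4 × F) (Fin 4 × F) ℂ)
    (A : Fin 4 → (Fin 4 → ℝ) → Matrix (Fin 4 × F) (Fin 4 × F) ℂ)
    (B : (Fin 4 → ℝ) → Matrix (Fin 4 × F) (Fin 4 × F) ℂ) : Prop :=
  ∀ Ψ, P.SmoothSpinor Ψ → ∀ x ∈ P.M,
    P.dirac Φ (P.dirac Φ Ψ) x =
      -((∑ μ, ∑ ν, P.gInv x μ ν • pd P.M μ (pd P.M ν Ψ) x)
        + (∑ μ, A μ x *ᵥ pd P.M μ Ψ x) + B x *ᵥ Ψ x)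

/-- The connection form of a second order operator with first order coefficients `A^μ`:
`ω'_μ = (1/2) g_{μν} (A^ν + g^{rs} Γ^ν_{rs})`. -/
def squareConn (A : Fin 4 → (Fin 4 → ℝ) → Matrix (Fin 4 × F) (Fin 4 × F) ℂ) (μ : Fin 4)
    (x : Fin 4 → ℝ) : Matrix (Fin 4 × F) (Fin 4 × F) ℂ :=
  (1 / 2 : ℝ) • ∑ ν, P.g x μ ν •
    (A ν x + (∑ r, ∑ s, P.gInv x r s * P.christoffel ν r s x) • 1)

/-- `θ_μ = ω'_μ - ω_μ`. -/
def θ (A : Fin 4 → (Fin 4 → ℝ) → Matrix (Fin 4 × F) (Fin 4 × F) ℂ) (μ : Fin 4)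
    (x : Fin 4 → ℝ) : Matrix (Fin 4 × F) (Fin 4 × F) ℂ :=
  P.squareConn A μ x - P.spinConn μ x

/-- The zero order term relative to `∇' = ∇ + θ`:  if `D = γ^μ ∇_μ - Φ`, then
`D = γ^μ ∇'_μ - Φ'` with `Φ' = Φ + γ^μ θ_μ`. -/
def primedPotential (A : Fin 4 → (Fin 4 → ℝ) → Matrix (Fin 4 × F) (Fin 4 × F) ℂ)
    (Φ : (Fin 4 → ℝ) → Matrix (Fin 4 × F) (Fin 4 × F) ℂ) (x : Fin 4 → ℝ) :
    Matrix (Fin 4 × F) (Fin 4 × F) ℂ :=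
  Φ x + ∑ μ, P.gamma μ x * P.θ A μ x

/-! Boundary operators. -/

/-- The tangential component `C_a = C_μ e_a^μ` of a matrix-valued one-form. -/
def tangentialPart (C : Fin 4 → (Fin 4 → ℝ) → Matrix (Fin 4 × F) (Fin 4 × F) ℂ) (a : Fin 3)
    (y : Fin 3 → ℝ) : Matrix (Fin 4 × F) (Fin 4 × F) ℂ :=
  ∑ μ, P.tangent a μ y • C μ (P.emb y)

/-- `∇'_a χ = ∂_a χ + [ω'_a, χ]`. -/
def covχ (A : Fin 4 → (Fin 4 → ℝ) → Matrix (Fin 4 × F) (Fin 4 × F) ℂ) (a : Fin 3)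
    (y : Fin 3 → ℝ) : Matrix (Fin 4 × F) (Fin 4 × F) ℂ :=
  pdMat P.V a P.χ y + (P.tangentialPart (P.squareConn A) a y * P.χ y
    - P.χ y * P.tangentialPart (P.squareConn A) a y)

/-- `S = Π_+ (γ_n Φ - (1/2) γ_n γ^a ∇'_a χ) Π_+`. -/
def robin (A : Fin 4 → (Fin 4 → ℝ) → Matrix (Fin 4 × F) (Fin 4 × F) ℂ)
    (Φ : (Fin 4 → ℝ) → Matrix (Fin 4 × F) (Fin 4 × F) ℂ) (y : Fin 3 → ℝ) :
    Matrix (Fin 4 × F) (Fin 4 × F) ℂ :=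
  P.projP y * (P.gammaN y * Φ (P.emb y)
    - (1 / 2 : ℝ) • ∑ a, P.gammaN y * P.gammaT a y * P.covχ A a y) * P.projP y

/-- The normal derivative `∇'_n = n^μ ∇'_μ` at the boundary. -/
def covN (A : Fin 4 → (Fin 4 → ℝ) → Matrix (Fin 4 × F) (Fin 4 × F) ℂ)
    (Ψ : (Fin 4 → ℝ) → (Fin 4 × F → ℂ)) (y : Fin 3 → ℝ) : Fin 4 × F → ℂ :=
  ∑ μ, P.normal μ y • P.cov (P.squareConn A) μ Ψ (P.emb y)

/-- `X` extends `χ` from the boundary to a smooth field of involutions on a neighbourhood of the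
boundary point `x(y)` in the manifold. -/
def IsExtensionAt (y : Fin 3 → ℝ) (X : (Fin 4 → ℝ) → Matrix (Fin 4 × F) (Fin 4 × F) ℂ) : Prop :=
  (∃ U : Set (Fin 4 → ℝ), IsOpen U ∧ P.emb y ∈ U ∧ SmoothMat (P.M ∩ U) X ∧
    ∀ x ∈ P.M ∩ U, X x * X x = 1) ∧
  ∀ᶠ z in nhds y, X (P.emb z) = P.χ z

/-- The mixed boundary operator `Π_- Ψ ⊕ Π_+ (∇'_n + S) Π_+ Ψ` at the boundary point `x(y)`.  In the
term `∇'_n Π_+ Ψ` the field `Π_+` is extended off the boundary as `(1 + X) / 2`. -/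
def mixedOp (A : Fin 4 → (Fin 4 → ℝ) → Matrix (Fin 4 × F) (Fin 4 × F) ℂ)
    (S : (Fin 3 → ℝ) → Matrix (Fin 4 × F) (Fin 4 × F) ℂ)
    (X : (Fin 4 → ℝ) → Matrix (Fin 4 × F) (Fin 4 × F) ℂ)
    (Ψ : (Fin 4 → ℝ) → (Fin 4 × F → ℂ)) (y : Fin 3 → ℝ) :
    (Fin 4 × F → ℂ) × (Fin 4 × F → ℂ) :=
  (P.projM y *ᵥ Ψ (P.emb y),
    P.projP y *ᵥ (P.covN A (fun x => ((1 / 2 : ℝ) • (1 + X x)) *ᵥ Ψ x) y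
      + S y *ᵥ (P.projP y *ᵥ Ψ (P.emb y))))

/-- The boundary condition `Π_- Ψ |_{∂M} = 0` of the Dirac operator. -/
def DirichletBC (Ψ : (Fin 4 → ℝ) → (Fin 4 × F → ℂ)) : Prop :=
  ∀ y ∈ P.V, P.projM y *ᵥ Ψ (P.emb y) = 0

/-- The induced boundary condition of `D²`: both `Ψ` and `D Ψ` satisfy the boundary condition
of `D`. -/
def SquareBC (Φ : (Fin 4 → ℝ) → Matrix (Fin 4 × F) (Fin 4 × F) ℂ)
    (Ψ : (Fin 4 → ℝ) → (Fin 4 × F → ℂ)) : Prop :=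
  P.DirichletBC Ψ ∧ P.DirichletBC (P.dirac Φ Ψ)

/-- The zero order term of the Dirac operator
`γ^μ (∂_μ + ω_μ + 1 ⊗ B_μ) + 1 ⊗ H` of an almost commutative space, with `γ^μ = e^μ_α γ^α ⊗ γF`:
`Φ = -(γ^μ (1 ⊗ B_μ) + 1 ⊗ H)`. -/
def modelPotential (B : Fin 4 → (Fin 4 → ℝ) → Matrix F F ℂ) (H : (Fin 4 → ℝ) → Matrix F F ℂ)
    (x : Fin 4 → ℝ) : Matrix (Fin 4 × F) (Fin 4 × F) ℂ :=
  -((∑ μ, P.gamma μ x * ((1 : Matrix (Fin 4) (Fin 4) ℂ) ⊗ₖ B μ x))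
    + (1 : Matrix (Fin 4) (Fin 4) ℂ) ⊗ₖ H x)

end DiracPatch

end

end DiracBoundary

/-! In the bulk everything rests on two facts: `{γ^μ, γ^ν} = -2 g^{μν}`, and the gamma matrices are
covariantly constant for the spin connection (`matDeriv_gamma`). Expanding `D²` by the product rule,
the second order part collapses to `-g^{μν} ∂_μ ∂_ν` because second partial derivatives commute,
also at boundary points. Covariant constancy turns the first order part into `2 ω^ν`, a Christoffel
trace and `{γ^ν, Φ}`. The Christoffel trace is exactly what the definition of `ω'` removes, so `θ_μ
= ½ {γ_μ, Φ}` (`θ_eq`). Constant and linear test fields show that the coefficients of `D²` are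
unique (`squareForm_unique`), so this holds for every admissible `A`.

On the boundary, `χ` is the normalized volume element of a three-dimensional Clifford algebra. It
squares to `1`, commutes with each `γ^a` and anticommutes with `γ^n`. Its derivative is found
without differentiating its formula (`spinorCov_chi`): differentiating `χ² = 1` and `[χ, γ_b] = 0`,
with the Gauss formula for the derivative of `γ_b`, gives relations which determine `∇_a χ` uniquely
and which `K_{ab} χ γ^n γ^b` satisfies.

For the boundary condition (`squareBC_iff`), suppose `χ Ψ = Ψ` on the boundary. Then `(1 - χ) ∇'_a Ψ
= (∇'_a χ) Ψ`, so in `(1 - χ) D Ψ` the tangential derivatives become zero order terms.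
Multiplication by the invertible `γ_n` turns `(1 - χ) D Ψ` into `-2 Π_+ (∇'_n + S) Π_+ Ψ`. The
extension of `χ` is irrelevant because the derivative of an involution exchanges its two
eigenspaces.

In the special cases `θ_a` commutes with `χ`, while `γ_n Φ` and `γ_n Φ'` anticommute with it. The
projections then kill the potential, and only the contraction of `K_{ab}` with `γ^a γ^b` survives,
which gives `-½ K Π_+` (`robin_eq`). -/

namespace DiracBoundary

noncomputable section

/-! ### Partial derivatives within a set, for functions and entrywise for matrices. -/

section Calculus

variable {k : ℕ} {W : Type*} [NormedAddCommGroup W] [NormedSpace ℝ W] {s : Set (Fin k → ℝ)}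
  {x : Fin k → ℝ} {i : Fin k}

theorem pd_const (c : W) : pd s i (fun _ => c) x = 0 := by
  simp [pd]

theorem pd_congr {f g : (Fin k → ℝ) → W} (h : f =ᶠ[nhdsWithin x s] g) (hx : x ∈ s) :
    pd s i f x = pd s i g x := by
  rw [pd, pd, h.fderivWithin_eq_of_mem hx]

theorem pd_add (hs : UniqueDiffWithinAt ℝ s x) {f g : (Fin k → ℝ) → W}
    (hf : DifferentiableWithinAt ℝ f s x) (hg : DifferentiableWithinAt ℝ g s x) :
    pd s i (fun z => f z + g z) x = pd s i f x + pd s i g x := by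
  simp only [pd]; rw [fderivWithin_fun_add hs hf hg]; rfl

theorem pd_sum (hs : UniqueDiffWithinAt ℝ s x) {ι : Type*} (u : Finset ι)
    {f : ι → (Fin k → ℝ) → W} (hf : ∀ j ∈ u, DifferentiableWithinAt ℝ (f j) s x) :
    pd s i (fun z => ∑ j ∈ u, f j z) x = ∑ j ∈ u, pd s i (f j) x := by
  simp only [pd]; rw [fderivWithin_fun_sum hs hf]; simp

theorem pd_smul (hs : UniqueDiffWithinAt ℝ s x) {f : (Fin k → ℝ) → ℝ} {g : (Fin k → ℝ) → W}
    (hf : DifferentiableWithinAt ℝ f s x) (hg : DifferentiableWithinAt ℝ g s x) :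
    pd s i (fun z => f z • g z) x = f x • pd s i g x + pd s i f x • g x := by
  simp only [pd]; rw [fderivWithin_fun_smul hs hf hg]; simp

theorem pd_mul (hs : UniqueDiffWithinAt ℝ s x) {R : Type*} [NormedCommRing R] [NormedAlgebra ℝ R]
    {f g : (Fin k → ℝ) → R}
    (hf : DifferentiableWithinAt ℝ f s x) (hg : DifferentiableWithinAt ℝ g s x) :
    pd s i (fun z => f z * g z) x = pd s i f x * g x + f x * pd s i g x := by
  simp only [pd]; rw [fderivWithin_fun_mul hs hf hg]
  simp [mul_comm, add_comm]

theorem pd_apply (hs : UniqueDiffWithinAt ℝ s x) {ι : Type*} [Fintype ι] {f : (Fin k → ℝ) → ι → W}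
    (hf : DifferentiableWithinAt ℝ f s x) (p : ι) :
    pd s i f x p = pd s i (fun z => f z p) x := by
  simp only [pd]; rw [fderivWithin_apply hf hs p]; rfl

theorem contDiffOn_pd (hs : UniqueDiffOn ℝ s) {f : (Fin k → ℝ) → W} (hf : ContDiffOn ℝ ∞ f s) :
    ContDiffOn ℝ ∞ (pd s i f) s := by
  have h : ContDiffOn ℝ ∞ (fderivWithin ℝ f s) s := hf.fderivWithin hs (by norm_num)
  exact h.clm_apply contDiffOn_const

/-- Symmetry of the second derivative passes by continuity from the interior of `s` to its limit
points. This is the form needed at boundary points of the manifold. -/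
theorem pd_comm (hs : UniqueDiffOn ℝ s) (hc : x ∈ closure (interior s)) (hx : x ∈ s)
    {f : (Fin k → ℝ) → W} (hf : ContDiffOn ℝ ∞ f s) (j : Fin k) :
    pd s i (pd s j f) x = pd s j (pd s i f) x := by
  have h : ContDiffOn ℝ ∞ (fderivWithin ℝ f s) s := hf.fderivWithin hs (by norm_num)
  have hd : DifferentiableWithinAt ℝ (fderivWithin ℝ f s) s x :=
    (h x hx).differentiableWithinAt (by norm_num)
  have key : ∀ i j : Fin k, pd s i (pd s j f) x
      = fderivWithin ℝ (fderivWithin ℝ f s) s x (Pi.single i 1) (Pi.single j 1) := by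
    intro i j
    have : fderivWithin ℝ (fun z => fderivWithin ℝ f s z (Pi.single j 1)) s x
        = (fderivWithin ℝ (fderivWithin ℝ f s) s x).flip (Pi.single j 1) := by
      rw [fderivWithin_clm_apply (hs x hx) hd (differentiableWithinAt_const _)]
      simp
    show fderivWithin ℝ (fun z => fderivWithin ℝ f s z (Pi.single j 1)) s x (Pi.single i 1) = _
    rw [this]; rfl
  rw [key, key]
  refine ((hf x hx).isSymmSndFDerivWithinAt ?_ hs hc hx) _ _
  -- Over `ℝ` the symmetry of second derivatives requires only class `C²`.
  rw [minSmoothness_of_isRCLikeNormedField]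
  exact WithTop.coe_le_coe.2 (le_top : (2 : ℕ∞) ≤ ⊤)

theorem fderivWithin_eq_sum_pd {f : (Fin k → ℝ) → W} (v : Fin k → ℝ) :
    fderivWithin ℝ f s x v = ∑ j, v j • pd s j f x := by
  conv_lhs => rw [← Finset.univ_sum_single v]
  rw [map_sum]
  refine Finset.sum_congr rfl fun j _ => ?_
  rw [pd, ← map_smul]; congr 1; rw [← Pi.single_smul]; simp

theorem pd_comp {l : ℕ} {t : Set (Fin l → ℝ)} {y : Fin l → ℝ} {a : Fin l}
    {f : (Fin k → ℝ) → W} {c : (Fin l → ℝ) → (Fin k → ℝ)} (ht : UniqueDiffWithinAt ℝ t y)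
    (hf : DifferentiableWithinAt ℝ f s (c y)) (hc : DifferentiableWithinAt ℝ c t y)
    (hm : Set.MapsTo c t s) :
    pd t a (fun z => f (c z)) y = ∑ j, pd t a c y j • pd s j f (c y) := by
  have := (hf.hasFDerivWithinAt.comp y hc.hasFDerivWithinAt hm).fderivWithin ht
  have e : pd t a (fun z => f (c z)) y = fderivWithin ℝ (f ∘ c) t y (Pi.single a 1) := rfl
  rw [e, this]
  exact fderivWithin_eq_sum_pd _

/-- The entrywise partial derivative of a matrix with entries in a normed algebra. -/
def matDeriv {ι R : Type*} [NormedRing R] [NormedAlgebra ℝ R] (s : Set (Fin k → ℝ)) (i : Fin k)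
    (A : (Fin k → ℝ) → Matrix ι ι R) (x : Fin k → ℝ) : Matrix ι ι R :=
  Matrix.of fun p q => pd s i (fun z => A z p q) x

theorem pdMat_eq_matDeriv {ι : Type*} (A : (Fin k → ℝ) → Matrix ι ι ℂ) :
    pdMat s i A x = matDeriv s i A x := rfl

/-- Entrywise differentiability within a set. -/
def DiffMat {ι R : Type*} [NormedRing R] [NormedAlgebra ℝ R] (s : Set (Fin k → ℝ))
    (A : (Fin k → ℝ) → Matrix ι ι R) (x : Fin k → ℝ) : Prop :=
  ∀ p q, DifferentiableWithinAt ℝ (fun z => A z p q) s x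

section Mat

variable {ι κ R : Type*} [NormedCommRing R] [NormedAlgebra ℝ R]

theorem SmoothMat.diffMat {A : (Fin k → ℝ) → Matrix ι ι R} (hA : SmoothMat s A) (hx : x ∈ s) :
    DiffMat s A x := fun p q => (hA p q x hx).differentiableWithinAt (by norm_num)

theorem smoothMat_const (A : Matrix ι ι R) : SmoothMat s (fun _ => A) :=
  fun _ _ => contDiffOn_const

theorem SmoothMat.add {A B : (Fin k → ℝ) → Matrix ι ι R} (hA : SmoothMat s A)
    (hB : SmoothMat s B) : SmoothMat s (fun x => A x + B x) :=
  fun p q => (hA p q).add (hB p q)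

theorem SmoothMat.sub {A B : (Fin k → ℝ) → Matrix ι ι R} (hA : SmoothMat s A)
    (hB : SmoothMat s B) : SmoothMat s (fun x => A x - B x) :=
  fun p q => (hA p q).sub (hB p q)

theorem SmoothMat.neg {A : (Fin k → ℝ) → Matrix ι ι R} (hA : SmoothMat s A) :
    SmoothMat s (fun x => -A x) :=
  fun p q => (hA p q).neg

theorem SmoothMat.sum {J : Type*} (u : Finset J) {A : J → (Fin k → ℝ) → Matrix ι ι R}
    (hA : ∀ j, SmoothMat s (A j)) : SmoothMat s (fun x => ∑ j ∈ u, A j x) := by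
  intro p q
  simp only [Matrix.sum_apply]
  exact ContDiffOn.sum fun j _ => hA j p q

theorem SmoothMat.smul {f : (Fin k → ℝ) → ℝ} {A : (Fin k → ℝ) → Matrix ι ι R}
    (hf : ContDiffOn ℝ ∞ f s) (hA : SmoothMat s A) : SmoothMat s (fun x => f x • A x) :=
  fun p q => hf.smul (hA p q)

theorem SmoothMat.transpose {A : (Fin k → ℝ) → Matrix ι ι R} (hA : SmoothMat s A) :
    SmoothMat s (fun x => (A x)ᵀ) := fun p q => hA q p

theorem SmoothMat.mul [Fintype ι] {A B : (Fin k → ℝ) → Matrix ι ι R} (hA : SmoothMat s A)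
    (hB : SmoothMat s B) : SmoothMat s (fun x => A x * B x) := by
  intro p q
  simp only [Matrix.mul_apply]
  exact ContDiffOn.sum fun j _ => (hA p j).mul (hB j q)

theorem SmoothMat.kronecker {A : (Fin k → ℝ) → Matrix ι ι R} (hA : SmoothMat s A)
    (B : Matrix κ κ R) : SmoothMat s (fun x => A x ⊗ₖ B) :=
  fun p q => (hA p.1 q.1).mul contDiffOn_const

theorem SmoothMat.matDeriv {A : (Fin k → ℝ) → Matrix ι ι R} (hs : UniqueDiffOn ℝ s)
    (hA : SmoothMat s A) : SmoothMat s (matDeriv s i A) :=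
  fun p q => contDiffOn_pd hs (hA p q)

theorem SmoothMat.comp {l : ℕ} {t : Set (Fin l → ℝ)} {c : (Fin l → ℝ) → (Fin k → ℝ)}
    {A : (Fin k → ℝ) → Matrix ι ι W} (hA : SmoothMat s A)
    (hc : ContDiffOn ℝ ∞ c t) (hm : Set.MapsTo c t s) : SmoothMat t (fun z => A (c z)) :=
  fun p q => (hA p q).comp hc hm

theorem contDiffOn_det [Fintype ι] [DecidableEq ι] {A : (Fin k → ℝ) → Matrix ι ι R}
    (hA : SmoothMat s A) : ContDiffOn ℝ ∞ (fun x => (A x).det) s := by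
  simp only [Matrix.det_apply']
  exact ContDiffOn.sum fun σ _ => contDiffOn_const.mul (contDiffOn_prod fun j _ => hA _ _)

theorem SmoothMat.inv [Fintype ι] [DecidableEq ι] {A : (Fin k → ℝ) → Matrix ι ι ℝ}
    (hA : SmoothMat s A) (hd : ∀ x ∈ s, (A x).det ≠ 0) : SmoothMat s (fun x => (A x)⁻¹) := by
  intro p q
  -- Cramer's rule: each entry of the inverse is a quotient of two determinants, hence of two
  -- polynomials in smooth functions.
  have h : ∀ x, (A x)⁻¹ p q = ((A x).det)⁻¹ * ((A x).updateRow q (Pi.single p 1)).det := by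
    intro x
    rw [Matrix.inv_def, Matrix.smul_apply, Matrix.adjugate_apply, Ring.inverse_eq_inv', smul_eq_mul]
  simp only [h]
  refine ((contDiffOn_det hA).inv hd).mul (contDiffOn_det ?_)
  intro a b
  by_cases hq : a = q
  · subst hq; simp only [Matrix.updateRow_self]; exact contDiffOn_const
  · simp only [Matrix.updateRow_ne hq]; exact hA a b

theorem SmoothMat.mulVec [Fintype ι] {A : (Fin k → ℝ) → Matrix ι ι R} (hA : SmoothMat s A)
    {v : (Fin k → ℝ) → ι → R} (hv : ContDiffOn ℝ ∞ v s) :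
    ContDiffOn ℝ ∞ (fun x => A x *ᵥ v x) s := by
  rw [contDiffOn_pi] at hv ⊢
  intro p
  simp only [Matrix.mulVec, dotProduct]
  exact ContDiffOn.sum fun j _ => (hA p j).mul (hv j)

theorem matDeriv_congr {A B : (Fin k → ℝ) → Matrix ι ι R}
    (h : A =ᶠ[nhdsWithin x s] B) (hx : x ∈ s) : matDeriv s i A x = matDeriv s i B x := by
  ext p q
  exact pd_congr (h.mono fun z hz => by simp only [hz]) hx

theorem matDeriv_const (A : Matrix ι ι R) : matDeriv s i (fun _ => A) x = 0 := by
  ext p q; simp [matDeriv, pd_const]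

theorem matDeriv_mul [Fintype ι] (hs : UniqueDiffWithinAt ℝ s x)
    {A B : (Fin k → ℝ) → Matrix ι ι R} (hA : DiffMat s A x) (hB : DiffMat s B x) :
    matDeriv s i (fun z => A z * B z) x = matDeriv s i A x * B x + A x * matDeriv s i B x := by
  ext p q
  simp only [matDeriv, Matrix.of_apply, Matrix.mul_apply, Matrix.add_apply]
  rw [pd_sum hs _ fun j _ => (hA p j).fun_mul (hB j q), ← Finset.sum_add_distrib]
  exact Finset.sum_congr rfl fun j _ => pd_mul hs (hA p j) (hB j q)

theorem matDeriv_sum_smul_const (hs : UniqueDiffWithinAt ℝ s x) {J : Type*} (u : Finset J)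
    {f : J → (Fin k → ℝ) → ℝ} (A : J → Matrix ι ι R)
    (hf : ∀ j, DifferentiableWithinAt ℝ (f j) s x) :
    matDeriv s i (fun z => ∑ j ∈ u, f j z • A j) x = ∑ j ∈ u, pd s i (f j) x • A j := by
  ext p q
  simp only [matDeriv, Matrix.of_apply, Matrix.sum_apply, Matrix.smul_apply]
  rw [pd_sum hs _ fun j _ => (hf j).smul_const _]
  refine Finset.sum_congr rfl fun j _ => ?_
  rw [pd_smul hs (hf j) (differentiableWithinAt_const _), pd_const, smul_zero, zero_add]

theorem matDeriv_kronecker (hs : UniqueDiffWithinAt ℝ s x) {A : (Fin k → ℝ) → Matrix ι ι R}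
    (hA : DiffMat s A x) (B : Matrix κ κ R) :
    matDeriv s i (fun z => A z ⊗ₖ B) x = matDeriv s i A x ⊗ₖ B := by
  ext p q
  simp only [matDeriv, Matrix.of_apply, Matrix.kroneckerMap_apply]
  rw [pd_mul hs (hA _ _) (differentiableWithinAt_const _), pd_const, mul_zero, add_zero]

theorem pd_mulVec [Fintype ι] (hs : UniqueDiffWithinAt ℝ s x) {A : (Fin k → ℝ) → Matrix ι ι R}
    {v : (Fin k → ℝ) → ι → R} (hA : DiffMat s A x) (hv : DifferentiableWithinAt ℝ v s x) :
    pd s i (fun z => A z *ᵥ v z) x = matDeriv s i A x *ᵥ v x + A x *ᵥ pd s i v x := by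
  have hv' := fun q => differentiableWithinAt_pi.1 hv q
  have hd : ∀ p, DifferentiableWithinAt ℝ (fun z => (A z *ᵥ v z) p) s x := fun p => by
    simp only [Matrix.mulVec, dotProduct]
    exact DifferentiableWithinAt.fun_sum fun j _ => (hA p j).fun_mul (hv' j)
  ext p
  rw [pd_apply hs (differentiableWithinAt_pi.2 hd)]
  simp only [matDeriv, Matrix.of_apply, Matrix.mulVec, dotProduct, Pi.add_apply]
  rw [pd_sum hs _ fun j _ => (hA p j).fun_mul (hv' j), ← Finset.sum_add_distrib]
  refine Finset.sum_congr rfl fun j _ => ?_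
  rw [pd_mul hs (hA p j) (hv' j), pd_apply hs hv]

end Mat

end Calculus

/-! ### Derivatives within the manifold are well defined up to the boundary. -/

namespace DiracPatch

variable {F : Type*} [Fintype F] [DecidableEq F] (P : DiracPatch F)

theorem differentiableAt_ρ {x : Fin 4 → ℝ} (hx : x ∈ P.Ω) : DifferentiableAt ℝ P.ρ x :=
  (P.smooth_ρ.contDiffAt (P.isOpen_Ω.mem_nhds hx)).differentiableAt (by norm_num)

/-- At a boundary point the difference quotient of `ρ` along `v` tends to `dρ(v) > 0`, so `ρ`
becomes positive immediately. Where `ρ x > 0` continuity suffices for any `v`. Stating `hv` as an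
implication covers both cases at once. -/
theorem eventually_mem_interior_M {x v : Fin 4 → ℝ} (hx : x ∈ P.M)
    (hv : P.ρ x = 0 → 0 < fderiv ℝ P.ρ x v) :
    ∀ᶠ t in nhdsWithin (0 : ℝ) (Set.Ioi 0), x + t • v ∈ P.Ω ∧ 0 < P.ρ (x + t • v) := by
  have hc : Filter.Tendsto (fun t : ℝ => x + t • v) (nhds 0) (nhds x) := by
    have : Continuous fun t : ℝ => x + t • v := by fun_prop
    simpa using this.tendsto 0
  have hΩ : ∀ᶠ t in nhds (0 : ℝ), x + t • v ∈ P.Ω := hc (P.isOpen_Ω.mem_nhds hx.1)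
  refine (hΩ.filter_mono nhdsWithin_le_nhds).and ?_
  rcases hx.2.lt_or_eq with h | h
  · have := (P.differentiableAt_ρ hx.1).continuousAt.eventually (lt_mem_nhds h)
    exact (hc.eventually this).filter_mono nhdsWithin_le_nhds
  · have hd : HasDerivAt (fun t : ℝ => P.ρ (x + t • v)) (fderiv ℝ P.ρ x v) 0 := by
      have h1 : HasDerivAt (fun t : ℝ => x + t • v) v 0 := by
        simpa using ((hasDerivAt_id (0 : ℝ)).smul_const v).const_add x
      have h2 : HasFDerivAt P.ρ (fderiv ℝ P.ρ x) (x + (0 : ℝ) • v) := by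
        simpa using (P.differentiableAt_ρ hx.1).hasFDerivAt
      exact h2.comp_hasDerivAt (0 : ℝ) h1
    have hs := hd.tendsto_slope_zero_right.eventually (lt_mem_nhds (hv h.symm))
    filter_upwards [hs, self_mem_nhdsWithin] with t ht ht0
    rw [Set.mem_Ioi] at ht0
    simp only [zero_add, zero_smul, add_zero, ← h, sub_zero, smul_eq_mul] at ht
    exact (mul_pos_iff_of_pos_left (inv_pos.2 ht0)).1 ht

theorem isOpen_pos : IsOpen {x | x ∈ P.Ω ∧ 0 < P.ρ x} :=
  P.smooth_ρ.continuousOn.isOpen_inter_preimage P.isOpen_Ω isOpen_Ioi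

theorem exists_inward {x : Fin 4 → ℝ} (hx : x ∈ P.M) :
    ∃ v, P.ρ x = 0 → 0 < fderiv ℝ P.ρ x v := by
  by_cases h : P.ρ x = 0
  · have := P.regular_ρ x hx.1 h
    obtain ⟨v, hv⟩ : ∃ v, fderiv ℝ P.ρ x v ≠ 0 := by
      by_contra hc; push Not at hc
      exact this (ContinuousLinearMap.ext hc)
    rcases lt_or_gt_of_ne hv with h1 | h1
    · exact ⟨-v, fun _ => by simpa using h1⟩
    · exact ⟨v, fun _ => h1⟩
  · exact ⟨0, fun h' => absurd h' h⟩

theorem mem_closure_interior {x : Fin 4 → ℝ} (hx : x ∈ P.M) : x ∈ closure (interior P.M) := by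
  obtain ⟨v, hv⟩ := P.exists_inward hx
  have h := P.eventually_mem_interior_M hx hv
  have hc : Filter.Tendsto (fun t : ℝ => x + t • v) (nhdsWithin 0 (Set.Ioi 0)) (nhds x) := by
    have : Continuous fun t : ℝ => x + t • v := by fun_prop
    simpa using (this.tendsto 0).mono_left nhdsWithin_le_nhds
  refine mem_closure_of_tendsto hc (h.mono fun t ht => ?_)
  have hsub : {x | x ∈ P.Ω ∧ 0 < P.ρ x} ⊆ P.M := fun z hz => ⟨hz.1, hz.2.le⟩
  exact interior_maximal hsub P.isOpen_pos ht

/-- The tangent cone contains all strictly inward vectors (all vectors at an interior point). They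
form a nonempty open set, so they span the whole space. -/
theorem uniqueDiffOn_M : UniqueDiffOn ℝ P.M := by
  intro x hx
  refine ⟨?_, subset_closure hx⟩
  have hcone : {v | P.ρ x = 0 → 0 < fderiv ℝ P.ρ x v} ⊆ tangentConeAt ℝ P.M x := by
    intro v hv
    refine mem_tangentConeAt_of_add_smul_mem (c := id) (l := nhdsWithin (0 : ℝ) (Set.Ioi 0)) ?_ ?_
    · exact Filter.tendsto_id.mono_left (nhdsWithin_mono _ fun t ht => ne_of_gt ht)
    · exact (P.eventually_mem_interior_M hx hv).mono fun t ht => ⟨ht.1, ht.2.le⟩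
  have hopen : IsOpen {v | P.ρ x = 0 → 0 < fderiv ℝ P.ρ x v} := by
    by_cases h : P.ρ x = 0
    · simp only [h, true_imp_iff]
      exact isOpen_lt continuous_const (fderiv ℝ P.ρ x).continuous
    · simp [h]
  have : Submodule.span ℝ (tangentConeAt ℝ P.M x) = ⊤ := by
    refine Submodule.eq_top_of_nonempty_interior' _ ?_
    obtain ⟨v, hv⟩ := P.exists_inward hx
    exact ⟨v, interior_maximal (Set.Subset.trans hcone Submodule.subset_span) hopen hv⟩
  rw [this]; simp

theorem uniqueDiffOn_V : UniqueDiffOn ℝ P.V := P.isOpen_V.uniqueDiffOn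

theorem mapsTo_emb : Set.MapsTo P.emb P.V P.M := fun y hy =>
  ⟨(P.emb_mem y hy).1, (P.emb_mem y hy).2.ge⟩

end DiracPatch

/-! ### Metric, spin connection and square of the Dirac operator in the bulk. -/

namespace DiracPatch

variable {F : Type*} [Fintype F] [DecidableEq F] (P : DiracPatch F) {x : Fin 4 → ℝ}

theorem isUnit_det_e (hx : x ∈ P.M) : IsUnit (P.e x).det := (P.det_e x hx.1 hx.2).isUnit

theorem e_mul_inv (hx : x ∈ P.M) : P.e x * (P.e x)⁻¹ = 1 :=
  Matrix.mul_nonsing_inv _ (P.isUnit_det_e hx)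

theorem inv_mul_e (hx : x ∈ P.M) : (P.e x)⁻¹ * P.e x = 1 :=
  Matrix.nonsing_inv_mul _ (P.isUnit_det_e hx)

theorem isUnit_det_g (hx : x ∈ P.M) : IsUnit (P.g x).det := by
  rw [g, Matrix.det_mul, Matrix.det_transpose]
  exact (P.isUnit_det_e hx).mul (P.isUnit_det_e hx)

theorem gInv_mul_g (hx : x ∈ P.M) : P.gInv x * P.g x = 1 :=
  Matrix.nonsing_inv_mul _ (P.isUnit_det_g hx)

theorem g_mul_gInv (hx : x ∈ P.M) : P.g x * P.gInv x = 1 :=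
  Matrix.mul_nonsing_inv _ (P.isUnit_det_g hx)

theorem g_transpose (x : Fin 4 → ℝ) : (P.g x)ᵀ = P.g x := by
  simp [g, Matrix.transpose_mul]

theorem g_symm (x : Fin 4 → ℝ) (μ ν : Fin 4) : P.g x μ ν = P.g x ν μ :=
  congrFun (congrFun (P.g_transpose x) ν) μ

theorem gInv_eq (x : Fin 4 → ℝ) : P.gInv x = ((P.e x)⁻¹)ᵀ * (P.e x)⁻¹ := by
  rw [gInv, g, Matrix.mul_inv_rev, Matrix.transpose_nonsing_inv]

theorem gInv_transpose (x : Fin 4 → ℝ) : (P.gInv x)ᵀ = P.gInv x := by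
  rw [gInv_eq, Matrix.transpose_mul, Matrix.transpose_transpose]

theorem gInv_symm (x : Fin 4 → ℝ) (μ ν : Fin 4) : P.gInv x μ ν = P.gInv x ν μ :=
  congrFun (congrFun (P.gInv_transpose x) ν) μ

/-! Smoothness of the geometric fields. -/

theorem smoothMat_e : SmoothMat P.M P.e := P.smooth_e

theorem smoothMat_g : SmoothMat P.M P.g := P.smoothMat_e.mul P.smoothMat_e.transpose

theorem smoothMat_gInv : SmoothMat P.M P.gInv :=
  P.smoothMat_g.inv fun _ hx => (P.isUnit_det_g hx).ne_zero

theorem smoothMat_eInv : SmoothMat P.M fun x => (P.e x)⁻¹ :=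
  P.smoothMat_e.inv fun _ hx => (P.isUnit_det_e hx).ne_zero

theorem contDiffOn_christoffel (r μ ν : Fin 4) : ContDiffOn ℝ ∞ (P.christoffel r μ ν) P.M := by
  have hg := fun i p q => contDiffOn_pd (i := i) P.uniqueDiffOn_M (P.smoothMat_g p q)
  exact contDiffOn_const.mul (ContDiffOn.sum fun s _ => (P.smoothMat_gInv r s).mul
    (((hg _ _ _).add (hg _ _ _)).sub (hg _ _ _)))

theorem contDiffOn_spinCoeff (μ α β : Fin 4) : ContDiffOn ℝ ∞ (P.spinCoeff μ α β) P.M :=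
  ContDiffOn.sum fun ν _ => ((contDiffOn_pd P.uniqueDiffOn_M (P.smoothMat_e ν α)).sub
    (ContDiffOn.sum fun r _ => (P.contDiffOn_christoffel r μ ν).mul (P.smoothMat_e r α))).mul
    (P.smoothMat_eInv β ν)

/-- The spin connection on the spinor space `ℂ⁴`. -/
def spinorConn (μ : Fin 4) (x : Fin 4 → ℝ) : Matrix (Fin 4) (Fin 4) ℂ :=
  (1 / 4 : ℝ) • ∑ α, ∑ β,
    P.spinCoeff μ α β x • ((1 / 2 : ℝ) • (P.γ α * P.γ β - P.γ β * P.γ α))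

theorem spinConn_eq (μ : Fin 4) : P.spinConn μ = fun x => P.spinorConn μ x ⊗ₖ (1 : Matrix F F ℂ) :=
  rfl

theorem smoothMat_spinorConn (μ : Fin 4) : SmoothMat P.M (P.spinorConn μ) :=
  SmoothMat.smul contDiffOn_const (SmoothMat.sum _ fun α => SmoothMat.sum _ fun β =>
    SmoothMat.smul (P.contDiffOn_spinCoeff μ α β) (smoothMat_const _))

theorem smoothMat_spinConn (μ : Fin 4) : SmoothMat P.M (P.spinConn μ) :=
  (P.smoothMat_spinorConn μ).kronecker _

theorem smoothMat_spinorGamma (μ : Fin 4) : SmoothMat P.M (P.spinorGamma μ) :=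
  SmoothMat.sum _ fun α => SmoothMat.smul (P.smoothMat_eInv α μ) (smoothMat_const _)

theorem smoothMat_gamma (μ : Fin 4) : SmoothMat P.M (P.gamma μ) :=
  (P.smoothMat_spinorGamma μ).kronecker _

/-! Metric compatibility and the spin connection. -/

theorem christoffel_symm (r μ ν : Fin 4) (x : Fin 4 → ℝ) :
    P.christoffel r μ ν x = P.christoffel r ν μ x := by
  have h : ∀ i p q, pd P.M i (fun z => P.g z p q) x = pd P.M i (fun z => P.g z q p) x :=
    fun i p q => by simp only [P.g_symm _ p q]
  simp only [christoffel]
  congr 1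
  refine Finset.sum_congr rfl fun s _ => ?_
  rw [h μ s ν, h ν μ s, h s μ ν]; ring

/-- Lowering the upper index cancels the inverse metric and leaves the Christoffel symbols of the
first kind, whose symmetrization gives `metric_compatible`. -/
theorem sum_christoffel_mul_g (hx : x ∈ P.M) (μ ν l : Fin 4) :
    ∑ r, P.christoffel r μ ν x * P.g x r l = (1 / 2) *
      (pd P.M μ (fun z => P.g z l ν) x + pd P.M ν (fun z => P.g z μ l) x
        - pd P.M l (fun z => P.g z μ ν) x) := by
  set E : Fin 4 → ℝ := fun s => pd P.M μ (fun z => P.g z s ν) x + pd P.M ν (fun z => P.g z μ s) x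
      - pd P.M s (fun z => P.g z μ ν) x with hE
  have h1 : ∀ s, ∑ r, P.gInv x s r * P.g x r l = if s = l then 1 else 0 := fun s => by
    have := congrFun (congrFun (P.gInv_mul_g hx) s) l
    rwa [Matrix.mul_apply, Matrix.one_apply] at this
  calc ∑ r, P.christoffel r μ ν x * P.g x r l
      = ∑ r, ∑ s, 1 / 2 * (E s * (P.gInv x s r * P.g x r l)) := by
        refine Finset.sum_congr rfl fun r _ => ?_
        rw [christoffel, Finset.mul_sum, Finset.sum_mul]
        refine Finset.sum_congr rfl fun s _ => ?_
        rw [P.gInv_symm x r s]; simp only [hE]; ring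
    _ = ∑ s, 1 / 2 * (E s * ∑ r, P.gInv x s r * P.g x r l) := by
        rw [Finset.sum_comm]; simp only [Finset.mul_sum]
    _ = _ := by simp only [h1]; simp [hE]

/-- The matrix `(Γ^r_{μν})_{ν r}`. -/
def christoffelMat (μ : Fin 4) (x : Fin 4 → ℝ) : Matrix (Fin 4) (Fin 4) ℝ :=
  Matrix.of fun ν r => P.christoffel r μ ν x

theorem metric_compatible (hx : x ∈ P.M) (μ : Fin 4) :
    P.christoffelMat μ x * P.g x + (P.christoffelMat μ x * P.g x)ᵀ = matDeriv P.M μ P.g x := by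
  have h : ∀ i p q, pd P.M i (fun z => P.g z p q) x = pd P.M i (fun z => P.g z q p) x :=
    fun i p q => by simp only [P.g_symm _ p q]
  ext ν l
  simp only [Matrix.add_apply, Matrix.transpose_apply, Matrix.mul_apply, christoffelMat,
    Matrix.of_apply, matDeriv]
  rw [P.sum_christoffel_mul_g hx, P.sum_christoffel_mul_g hx, h μ l ν, h ν μ l, h l μ ν]; ring

/-- The matrix `(ω_μ^{αβ})_{βα}` of coefficients of the spin connection. -/
def spinCoeffMat (μ : Fin 4) (x : Fin 4 → ℝ) : Matrix (Fin 4) (Fin 4) ℝ :=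
  (P.e x)⁻¹ * (matDeriv P.M μ P.e x - P.christoffelMat μ x * P.e x)

theorem spinCoeffMat_apply (μ α β : Fin 4) : P.spinCoeffMat μ x β α = P.spinCoeff μ α β x := by
  simp only [spinCoeffMat, Matrix.mul_apply, Matrix.sub_apply, matDeriv, Matrix.of_apply,
    christoffelMat, spinCoeff, eInv]
  exact Finset.sum_congr rfl fun ν _ => mul_comm _ _

theorem e_mul_spinCoeffMat (hx : x ∈ P.M) (μ : Fin 4) : P.e x * P.spinCoeffMat μ x =
    matDeriv P.M μ P.e x - P.christoffelMat μ x * P.e x := by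
  rw [spinCoeffMat, ← mul_assoc, P.e_mul_inv hx, one_mul]

/-- Inserting `∂e = e ω + Γ e` into the derivative of `g = e eᵀ` and comparing with metric
compatibility leaves `e (ω + ωᵀ) eᵀ = 0`, where `e` is invertible. -/
theorem spinCoeffMat_antisymm (hx : x ∈ P.M) (μ : Fin 4) :
    P.spinCoeffMat μ x + (P.spinCoeffMat μ x)ᵀ = 0 := by
  have hd : DiffMat P.M P.e x := P.smoothMat_e.diffMat hx
  have hdt : DiffMat P.M (fun z => (P.e z)ᵀ) x := P.smoothMat_e.transpose.diffMat hx
  have h1 := P.metric_compatible hx μ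
  have h2 : matDeriv P.M μ P.g x
      = matDeriv P.M μ P.e x * (P.e x)ᵀ + P.e x * (matDeriv P.M μ P.e x)ᵀ :=
    matDeriv_mul (P.uniqueDiffOn_M x hx) hd hdt
  have h3 : matDeriv P.M μ P.e x = P.e x * P.spinCoeffMat μ x + P.christoffelMat μ x * P.e x := by
    rw [P.e_mul_spinCoeffMat hx]; abel
  rw [h2, h3] at h1
  have h4 : P.e x * (P.spinCoeffMat μ x + (P.spinCoeffMat μ x)ᵀ) * (P.e x)ᵀ = 0 := by
    simp only [g, Matrix.transpose_mul, Matrix.transpose_add, Matrix.transpose_transpose,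
      Matrix.add_mul, Matrix.mul_add, Matrix.mul_assoc] at h1 ⊢
    have := sub_eq_zero.2 h1.symm
    rw [← this]; abel
  have h5 : (P.e x)ᵀ * ((P.e x)⁻¹)ᵀ = 1 := by
    rw [← Matrix.transpose_mul, P.inv_mul_e hx, Matrix.transpose_one]
  calc P.spinCoeffMat μ x + (P.spinCoeffMat μ x)ᵀ
      = ((P.e x)⁻¹ * P.e x) * (P.spinCoeffMat μ x + (P.spinCoeffMat μ x)ᵀ)
        * ((P.e x)ᵀ * ((P.e x)⁻¹)ᵀ) := by rw [P.inv_mul_e hx, h5, one_mul, mul_one]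
    _ = (P.e x)⁻¹ * (P.e x * (P.spinCoeffMat μ x + (P.spinCoeffMat μ x)ᵀ) * (P.e x)ᵀ)
        * ((P.e x)⁻¹)ᵀ := by simp only [Matrix.mul_assoc]
    _ = 0 := by rw [h4]; simp

theorem spinCoeff_antisymm (hx : x ∈ P.M) (μ α β : Fin 4) :
    P.spinCoeff μ α β x = -P.spinCoeff μ β α x := by
  have := congrFun (congrFun (P.spinCoeffMat_antisymm hx μ) β) α
  simp only [Matrix.add_apply, Matrix.transpose_apply, P.spinCoeffMat_apply,
    Matrix.zero_apply] at this
  linarith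

/-! Clifford algebra. -/

/-- The Clifford relation as a reordering rule. Its scalar is real, so that `module` over `ℝ` can
close the later computations. -/
theorem γ_mul_comm (α β : Fin 4) :
    P.γ α * P.γ β = (if α = β then (-2 : ℝ) else 0) • 1 - P.γ β * P.γ α := by
  have h := P.clifford α β
  rw [eq_sub_iff_add_eq, h]
  split_ifs
  · rw [neg_smul, ofNat_smul_eq_nsmul]; simp
  · simp

/-- Commutation with a bivector acts on vectors as an infinitesimal rotation. The formula follows by
moving `γ δ` to the right through both factors. -/
theorem commutator_γ (α β δ : Fin 4) :
    (P.γ α * P.γ β - P.γ β * P.γ α) * P.γ δ - P.γ δ * (P.γ α * P.γ β - P.γ β * P.γ α)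
      = (if α = δ then (4 : ℝ) else 0) • P.γ β - (if β = δ then (4 : ℝ) else 0) • P.γ α := by
  have h1 : P.γ δ * P.γ α = _ := P.γ_mul_comm δ α
  have h2 : P.γ δ * P.γ β = _ := P.γ_mul_comm δ β
  rw [mul_sub, ← mul_assoc, ← mul_assoc, h1, h2, sub_mul, sub_mul, sub_mul, mul_assoc _ (P.γ δ),
    mul_assoc _ (P.γ δ), h1, h2, mul_sub, mul_sub]
  simp only [smul_mul_assoc, mul_smul_comm, one_mul, mul_one, mul_assoc, eq_comm (a := δ)]
  split_ifs <;> module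

/-- The normalization `1/4` in the spin connection is made for this: `1/8` times the `4` of
`commutator_γ`, doubled because the two resulting sums agree by antisymmetry of `ω`, is `1`. -/
theorem commutator_spinorConn (hx : x ∈ P.M) (μ δ : Fin 4) :
    P.spinorConn μ x * P.γ δ - P.γ δ * P.spinorConn μ x
      = ∑ β, P.spinCoeff μ δ β x • P.γ β := by
  have h : P.spinorConn μ x * P.γ δ - P.γ δ * P.spinorConn μ x = (1 / 8 : ℝ) • ∑ α, ∑ β,
      P.spinCoeff μ α β x • ((P.γ α * P.γ β - P.γ β * P.γ α) * P.γ δ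
        - P.γ δ * (P.γ α * P.γ β - P.γ β * P.γ α)) := by
    simp only [spinorConn, smul_mul_assoc, mul_smul_comm, Finset.sum_mul, Finset.mul_sum,
      ← smul_sub, ← Finset.sum_sub_distrib, Finset.smul_sum]
    refine Finset.sum_congr rfl fun α _ => Finset.sum_congr rfl fun β _ => ?_
    module
  rw [h]
  have e1 : ∑ α, ∑ β, P.spinCoeff μ α β x • ((if α = δ then (4 : ℝ) else 0) • P.γ β)
      = ∑ β, P.spinCoeff μ δ β x • ((4 : ℝ) • P.γ β) := by
    rw [Finset.sum_comm]; simp [ite_smul, smul_ite]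
  have e2 : ∑ α, ∑ β, P.spinCoeff μ α β x • ((if β = δ then (4 : ℝ) else 0) • P.γ α)
      = ∑ β, P.spinCoeff μ β δ x • ((4 : ℝ) • P.γ β) := by
    simp [ite_smul, smul_ite]
  simp only [P.commutator_γ, smul_sub, Finset.sum_sub_distrib]
  rw [e1, e2, ← smul_sub, ← Finset.sum_sub_distrib, Finset.smul_sum]
  refine Finset.sum_congr rfl fun β _ => ?_
  rw [P.spinCoeff_antisymm hx μ β δ]; module

theorem matDeriv_inv_e (hx : x ∈ P.M) (μ : Fin 4) :
    matDeriv P.M μ (fun z => (P.e z)⁻¹) x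
      = -(P.spinCoeffMat μ x * (P.e x)⁻¹ + (P.e x)⁻¹ * P.christoffelMat μ x) := by
  have h := matDeriv_mul (i := μ) (P.uniqueDiffOn_M x hx) (P.smoothMat_e.diffMat hx)
    (P.smoothMat_eInv.diffMat hx)
  have h0 : matDeriv P.M μ (fun z => P.e z * (P.e z)⁻¹) x = 0 := by
    rw [matDeriv_congr (B := fun _ => 1) _ hx, matDeriv_const]
    filter_upwards [self_mem_nhdsWithin] with z hz using P.e_mul_inv hz
  have h3 : matDeriv P.M μ P.e x = P.e x * P.spinCoeffMat μ x + P.christoffelMat μ x * P.e x := by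
    rw [P.e_mul_spinCoeffMat hx]; abel
  rw [h0, h3] at h
  have h4 := congrArg ((P.e x)⁻¹ * ·) h.symm
  simp only [mul_add, add_mul, ← mul_assoc, P.inv_mul_e hx, one_mul, mul_zero] at h4
  rw [mul_assoc _ (P.e x), P.e_mul_inv hx, mul_one] at h4
  exact eq_neg_of_add_eq_zero_right h4

/-- The gamma matrices are covariantly constant. -/
theorem matDeriv_spinorGamma (hx : x ∈ P.M) (μ ν : Fin 4) :
    matDeriv P.M μ (P.spinorGamma ν) x = -(∑ l, P.christoffel ν μ l x • P.spinorGamma l x)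
      - (P.spinorConn μ x * P.spinorGamma ν x - P.spinorGamma ν x * P.spinorConn μ x) := by
  have h1 : matDeriv P.M μ (P.spinorGamma ν) x
      = ∑ α, matDeriv P.M μ (fun z => (P.e z)⁻¹) x α ν • P.γ α :=
    matDeriv_sum_smul_const (P.uniqueDiffOn_M x hx) _ _
      fun α => P.smoothMat_eInv.diffMat hx α ν
  have h2 : P.spinorConn μ x * P.spinorGamma ν x - P.spinorGamma ν x * P.spinorConn μ x
      = ∑ α, (P.spinCoeffMat μ x * (P.e x)⁻¹) α ν • P.γ α := by
    calc _ = ∑ δ, (P.e x)⁻¹ δ ν • (P.spinorConn μ x * P.γ δ - P.γ δ * P.spinorConn μ x) := by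
          simp only [spinorGamma, Finset.mul_sum, Finset.sum_mul, ← Finset.sum_sub_distrib, eInv,
            smul_sub, smul_mul_assoc, mul_smul_comm]
      _ = ∑ δ, ∑ β, ((P.e x)⁻¹ δ ν * P.spinCoeff μ δ β x) • P.γ β := by
          simp only [P.commutator_spinorConn hx, Finset.smul_sum, smul_smul]
      _ = _ := by
          rw [Finset.sum_comm]
          simp only [Matrix.mul_apply, P.spinCoeffMat_apply, Finset.sum_smul, mul_comm]
  have h3 : ∑ l, P.christoffel ν μ l x • P.spinorGamma l x
      = ∑ α, ((P.e x)⁻¹ * P.christoffelMat μ x) α ν • P.γ α := by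
    simp only [spinorGamma, Finset.smul_sum, smul_smul, Matrix.mul_apply, christoffelMat,
      Matrix.of_apply, Finset.sum_smul, eInv]
    rw [Finset.sum_comm]; simp only [mul_comm]
  rw [h1, h2, h3, P.matDeriv_inv_e hx, ← Finset.sum_neg_distrib, ← Finset.sum_sub_distrib]
  refine Finset.sum_congr rfl fun α _ => ?_
  rw [Matrix.neg_apply, Matrix.add_apply]; module

theorem spinorGamma_anticomm (μ ν : Fin 4) :
    P.spinorGamma μ x * P.spinorGamma ν x + P.spinorGamma ν x * P.spinorGamma μ x
      = (-2 * P.gInv x μ ν) • 1 := by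
  have h : P.spinorGamma μ x * P.spinorGamma ν x + P.spinorGamma ν x * P.spinorGamma μ x
      = ∑ α, ∑ β, (P.eInv μ α x * P.eInv ν β x) • (P.γ α * P.γ β + P.γ β * P.γ α) := by
    simp only [spinorGamma, Finset.sum_mul_sum, smul_add, Finset.sum_add_distrib, smul_mul_smul_comm]
    congr 1
    rw [Finset.sum_comm]
    simp only [mul_comm (P.eInv ν _ x)]
  rw [h, P.gInv_eq]
  have h2 : ∀ α β, P.γ α * P.γ β + P.γ β * P.γ α = (if α = β then (-2 : ℝ) else 0) • 1 :=
    fun α β => by rw [P.γ_mul_comm]; abel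
  simp only [h2, smul_ite, ite_smul, zero_smul, smul_smul, Finset.sum_ite_eq,
    Finset.mem_univ, if_true, Matrix.mul_apply, Matrix.transpose_apply, eInv, Finset.mul_sum,
    Finset.sum_smul, smul_zero, mul_comm]

theorem gamma_anticomm (μ ν : Fin 4) :
    P.gamma μ x * P.gamma ν x + P.gamma ν x * P.gamma μ x = (-2 * P.gInv x μ ν) • 1 := by
  simp only [gamma, ← Matrix.mul_kronecker_mul, P.γF_sq, ← Matrix.add_kronecker,
    P.spinorGamma_anticomm, Matrix.smul_kronecker, Matrix.one_kronecker_one]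

theorem matDeriv_gamma (hx : x ∈ P.M) (μ ν : Fin 4) :
    matDeriv P.M μ (P.gamma ν) x = -(∑ l, P.christoffel ν μ l x • P.gamma l x)
      - (P.spinConn μ x * P.gamma ν x - P.gamma ν x * P.spinConn μ x) := by
  have h : matDeriv P.M μ (P.gamma ν) x = matDeriv P.M μ (P.spinorGamma ν) x ⊗ₖ P.γF :=
    matDeriv_kronecker (P.uniqueDiffOn_M x hx) ((P.smoothMat_spinorGamma ν).diffMat hx) _
  rw [h, P.matDeriv_spinorGamma hx]
  ext p q
  simp only [gamma, spinConn_eq, ← Matrix.mul_kronecker_mul, mul_one, one_mul,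
    Matrix.kroneckerMap_apply, Matrix.sub_apply, Matrix.neg_apply, Matrix.sum_apply,
    Matrix.smul_apply, sub_mul, neg_mul, Finset.sum_mul, smul_mul_assoc]

/-! The square of the Dirac operator. -/

section Square

variable (Φ : (Fin 4 → ℝ) → Matrix (Fin 4 × F) (Fin 4 × F) ℂ)

/-- The zero order part `γ^μ ω_μ - Φ` of the Dirac operator. -/
def diracZero (x : Fin 4 → ℝ) : Matrix (Fin 4 × F) (Fin 4 × F) ℂ :=
  (∑ μ, P.gamma μ x * P.spinConn μ x) - Φ x

theorem dirac_eq (Ψ : (Fin 4 → ℝ) → (Fin 4 × F → ℂ)) (x : Fin 4 → ℝ) :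
    P.dirac Φ Ψ x = (∑ μ, P.gamma μ x *ᵥ pd P.M μ Ψ x) + P.diracZero Φ x *ᵥ Ψ x := by
  simp only [dirac, diracOp, cov, diracZero, Matrix.mulVec_add, Finset.sum_add_distrib,
    Matrix.sub_mulVec, Matrix.sum_mulVec, Matrix.mulVec_mulVec]
  abel

theorem smoothMat_diracZero (hΦ : SmoothMat P.M Φ) : SmoothMat P.M (P.diracZero Φ) :=
  SmoothMat.sub (SmoothMat.sum _ fun μ => (P.smoothMat_gamma μ).mul (P.smoothMat_spinConn μ)) hΦ

/-- The first order coefficients of the square of the Dirac operator. -/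
def squareCoeffOne (ν : Fin 4) (x : Fin 4 → ℝ) : Matrix (Fin 4 × F) (Fin 4 × F) ℂ :=
  -((∑ μ, P.gamma μ x * matDeriv P.M μ (P.gamma ν) x) + P.gamma ν x * P.diracZero Φ x
    + P.diracZero Φ x * P.gamma ν x)

/-- The zero order coefficient of the square of the Dirac operator. -/
def squareCoeffZero (x : Fin 4 → ℝ) : Matrix (Fin 4 × F) (Fin 4 × F) ℂ :=
  -((∑ μ, P.gamma μ x * matDeriv P.M μ (P.diracZero Φ) x) + P.diracZero Φ x * P.diracZero Φ x)

theorem smoothMat_squareCoeffOne (hΦ : SmoothMat P.M Φ) (ν : Fin 4) :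
    SmoothMat P.M (P.squareCoeffOne Φ ν) := by
  have hC := P.smoothMat_diracZero Φ hΦ
  exact SmoothMat.neg (SmoothMat.add (SmoothMat.add (SmoothMat.sum _ fun μ =>
    (P.smoothMat_gamma μ).mul (SmoothMat.matDeriv P.uniqueDiffOn_M (P.smoothMat_gamma ν)))
    ((P.smoothMat_gamma ν).mul hC)) (hC.mul (P.smoothMat_gamma ν)))

theorem smoothMat_squareCoeffZero (hΦ : SmoothMat P.M Φ) :
    SmoothMat P.M (P.squareCoeffZero Φ) := by
  have hC := P.smoothMat_diracZero Φ hΦ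
  exact SmoothMat.neg (SmoothMat.add (SmoothMat.sum _ fun μ =>
    (P.smoothMat_gamma μ).mul (SmoothMat.matDeriv P.uniqueDiffOn_M hC)) (hC.mul hC))

theorem smul_mulVec_real {ι : Type*} [Fintype ι] (c : ℝ) (A : Matrix ι ι ℂ) (v : ι → ℂ) :
    (c • A) *ᵥ v = c • (A *ᵥ v) := Matrix.smul_mulVec c A v

/-- Only the symmetric part of `γ^μ γ^ν` survives against a symmetric array, and the Clifford
relation fixes it. Twice the sum is computed, with the indices exchanged in one copy. -/
theorem sum_gamma_gamma_mulVec (T : Fin 4 → Fin 4 → (Fin 4 × F → ℂ)) (hT : ∀ μ ν, T μ ν = T ν μ) :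
    ∑ μ, ∑ ν, (P.gamma μ x * P.gamma ν x) *ᵥ T μ ν = -∑ μ, ∑ ν, P.gInv x μ ν • T μ ν := by
  have h : ∑ μ, ∑ ν, (P.gamma μ x * P.gamma ν x) *ᵥ T μ ν
      = ∑ μ, ∑ ν, (P.gamma ν x * P.gamma μ x) *ᵥ T μ ν := by
    rw [Finset.sum_comm]
    exact Finset.sum_congr rfl fun μ _ => Finset.sum_congr rfl fun ν _ => by rw [hT]
  have h2 : (2 : ℝ) • ∑ μ, ∑ ν, (P.gamma μ x * P.gamma ν x) *ᵥ T μ ν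
      = (2 : ℝ) • -∑ μ, ∑ ν, P.gInv x μ ν • T μ ν := by
    rw [two_smul]
    nth_rw 2 [h]
    simp only [← Finset.sum_add_distrib, ← Matrix.add_mulVec, P.gamma_anticomm, smul_mulVec_real,
      Matrix.one_mulVec, Finset.smul_sum, smul_smul, ← Finset.sum_neg_distrib, ← neg_smul,
      neg_mul, mul_neg]
  exact smul_right_injective _ (two_ne_zero (α := ℝ)) h2

theorem sum_smul_gamma_gamma (c : Fin 4 → Fin 4 → ℝ) (hc : ∀ μ ν, c μ ν = c ν μ) :
    ∑ μ, ∑ ν, c μ ν • (P.gamma μ x * P.gamma ν x)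
      = (-∑ μ, ∑ ν, P.gInv x μ ν * c μ ν) • (1 : Matrix (Fin 4 × F) (Fin 4 × F) ℂ) := by
  refine Matrix.ext_of_mulVec_single fun p => ?_
  have := P.sum_gamma_gamma_mulVec (x := x) (fun μ ν => c μ ν • Pi.single p 1)
    fun μ ν => by rw [hc]
  simp only [Matrix.mulVec_smul] at this
  simp only [Matrix.sum_mulVec, smul_mulVec_real, this, Matrix.one_mulVec, neg_smul, Matrix.neg_mulVec,
    Finset.sum_smul, smul_smul]

/-- The product rule applied to `γ^μ ∂_μ + C`, with `C` the zero order part. Commuting second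
derivatives reduce the principal part to the metric. -/
theorem isSquareForm_coeff (hΦ : SmoothMat P.M Φ) :
    P.IsSquareForm Φ (P.squareCoeffOne Φ) (P.squareCoeffZero Φ) := by
  intro Ψ hΨ x hx
  have hs := P.uniqueDiffOn_M
  have hC := P.smoothMat_diracZero Φ hΦ
  have hpd : ∀ ν, ContDiffOn ℝ ∞ (pd P.M ν Ψ) P.M := fun ν => contDiffOn_pd hs hΨ
  have hdiff : ∀ {f : (Fin 4 → ℝ) → (Fin 4 × F → ℂ)}, ContDiffOn ℝ ∞ f P.M →
      DifferentiableWithinAt ℝ f P.M x := fun hf => (hf x hx).differentiableWithinAt (by norm_num)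
  have hD : P.dirac Φ Ψ = fun z => (∑ ν, P.gamma ν z *ᵥ pd P.M ν Ψ z) + P.diracZero Φ z *ᵥ Ψ z :=
    funext (P.dirac_eq Φ Ψ)
  have hpdD : ∀ μ, pd P.M μ (P.dirac Φ Ψ) x
      = (∑ ν, (matDeriv P.M μ (P.gamma ν) x *ᵥ pd P.M ν Ψ x
          + P.gamma ν x *ᵥ pd P.M μ (pd P.M ν Ψ) x))
        + (matDeriv P.M μ (P.diracZero Φ) x *ᵥ Ψ x + P.diracZero Φ x *ᵥ pd P.M μ Ψ x) := by
    intro μ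
    have hg : ∀ ν, ContDiffOn ℝ ∞ (fun z => P.gamma ν z *ᵥ pd P.M ν Ψ z) P.M :=
      fun ν => (P.smoothMat_gamma ν).mulVec (hpd ν)
    rw [hD, pd_add (hs x hx) (hdiff (ContDiffOn.sum fun ν _ => hg ν)) (hdiff (hC.mulVec hΨ)),
      pd_sum (hs x hx) _ fun ν _ => hdiff (hg ν),
      pd_mulVec (hs x hx) (hC.diffMat hx) (hdiff hΨ)]
    congr 1
    exact Finset.sum_congr rfl fun ν _ =>
      pd_mulVec (hs x hx) ((P.smoothMat_gamma ν).diffMat hx) (hdiff (hpd ν))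
  have hsym := P.sum_gamma_gamma_mulVec (x := x) (fun μ ν => pd P.M μ (pd P.M ν Ψ) x)
    fun μ ν => pd_comm hs (P.mem_closure_interior hx) hx hΨ ν
  have h1 : ∑ ν, P.squareCoeffOne Φ ν x *ᵥ pd P.M ν Ψ x
      = -((∑ μ, ∑ ν, (P.gamma μ x * matDeriv P.M μ (P.gamma ν) x) *ᵥ pd P.M ν Ψ x)
        + (∑ ν, (P.gamma ν x * P.diracZero Φ x) *ᵥ pd P.M ν Ψ x)
        + ∑ ν, (P.diracZero Φ x * P.gamma ν x) *ᵥ pd P.M ν Ψ x) := by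
    rw [Finset.sum_comm]
    simp only [squareCoeffOne, Matrix.neg_mulVec, Matrix.add_mulVec, Matrix.sum_mulVec,
      Finset.sum_neg_distrib, Finset.sum_add_distrib]
  rw [P.dirac_eq Φ (P.dirac Φ Ψ) x, P.dirac_eq Φ Ψ x, h1, ← neg_eq_iff_eq_neg.2 hsym]
  simp only [hpdD, squareCoeffZero, Matrix.neg_mulVec, Matrix.add_mulVec, Matrix.sum_mulVec,
    Matrix.mulVec_add, Matrix.mulVec_sum, Matrix.mulVec_mulVec, Finset.sum_add_distrib]
  abel

/-- Two forms of `D²` share their principal part, which cancels. Constant fields then detect `B`,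
and the fields `z ν • e_p` detect column `p` of `A ν`. -/
theorem squareForm_unique {A A' : Fin 4 → (Fin 4 → ℝ) → Matrix (Fin 4 × F) (Fin 4 × F) ℂ}
    {B B' : (Fin 4 → ℝ) → Matrix (Fin 4 × F) (Fin 4 × F) ℂ} (h : P.IsSquareForm Φ A B)
    (h' : P.IsSquareForm Φ A' B') (hx : x ∈ P.M) : (∀ μ, A μ x = A' μ x) ∧ B x = B' x := by
  have key : ∀ Ψ, P.SmoothSpinor Ψ → (∑ μ, A μ x *ᵥ pd P.M μ Ψ x) + B x *ᵥ Ψ x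
      = (∑ μ, A' μ x *ᵥ pd P.M μ Ψ x) + B' x *ᵥ Ψ x := by
    intro Ψ hΨ
    have := (h Ψ hΨ x hx).symm.trans (h' Ψ hΨ x hx)
    rw [neg_inj, add_assoc, add_assoc] at this
    exact add_left_cancel this
  have hB : B x = B' x := by
    refine Matrix.ext_of_mulVec_single fun p => ?_
    simpa [pd_const] using key (fun _ => Pi.single p 1) contDiffOn_const
  refine ⟨fun ν => Matrix.ext_of_mulVec_single fun p => ?_, hB⟩
  have hco : ContDiff ℝ ∞ fun z : Fin 4 → ℝ => z ν := contDiff_apply ℝ ℝ ν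
  have hpd : ∀ μ, pd P.M μ (fun z : Fin 4 → ℝ => z ν • (Pi.single p 1 : Fin 4 × F → ℂ)) x
      = if μ = ν then Pi.single p 1 else 0 := by
    intro μ
    rw [pd_smul (P.uniqueDiffOn_M x hx) ((hco.differentiable (by norm_num)) x).differentiableWithinAt
      (differentiableWithinAt_const _), pd_const, smul_zero, zero_add]
    have : pd P.M μ (fun z : Fin 4 → ℝ => z ν) x = if μ = ν then 1 else 0 := by
      have h : HasFDerivWithinAt (fun z : Fin 4 → ℝ => z ν)
          (ContinuousLinearMap.proj (R := ℝ) (φ := fun _ : Fin 4 => ℝ) ν) P.M x :=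
        (hasFDerivAt_apply ν x).hasFDerivWithinAt
      rw [pd, h.fderivWithin (P.uniqueDiffOn_M x hx)]
      simp [Pi.single_apply, eq_comm]
    rw [this]; split_ifs <;> simp
  have := key (fun z => z ν • (Pi.single p 1 : Fin 4 × F → ℂ))
    (hco.contDiffOn.smul contDiffOn_const)
  rw [hB] at this
  have := add_right_cancel this
  simpa [hpd, apply_ite, Finset.sum_ite_eq'] using this

variable {Φ}

/-- `θ_μ = (1/2) {γ_μ, Φ}`. -/
theorem θ_eq {A : Fin 4 → (Fin 4 → ℝ) → Matrix (Fin 4 × F) (Fin 4 × F) ℂ}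
    {B : (Fin 4 → ℝ) → Matrix (Fin 4 × F) (Fin 4 × F) ℂ} (hΦ : SmoothMat P.M Φ)
    (h : P.IsSquareForm Φ A B) (hx : x ∈ P.M) (μ : Fin 4) :
    P.θ A μ x = (1 / 2 : ℝ) • ∑ ν, P.g x μ ν • (P.gamma ν x * Φ x + Φ x * P.gamma ν x) := by
  -- By covariant constancy `γ^μ ∂_μ γ^ν` equals `-Γ^ν_{μl} γ^μ γ^l - γ^μ ω_μ γ^ν + γ^μ γ^ν ω_μ`.
  -- The middle term cancels against `C γ^ν`, and the last one combines with `γ^ν C` to `{γ^μ, γ^ν}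
  -- ω_μ = -2 ω^ν`.
  have hA : ∀ ν, A ν x = (-∑ r, ∑ s, P.gInv x r s * P.christoffel ν r s x) • 1
      + (2 : ℝ) • (∑ l, P.gInv x ν l • P.spinConn l x)
      + (P.gamma ν x * Φ x + Φ x * P.gamma ν x) := by
    intro ν
    rw [(P.squareForm_unique Φ h (P.isSquareForm_coeff Φ hΦ) hx).1 ν]
    have h1 : ∑ l, P.gamma l x * (∑ s, P.christoffel ν l s x • P.gamma s x)
        = (-∑ r, ∑ s, P.gInv x r s * P.christoffel ν r s x) • 1 := by
      simp only [Finset.mul_sum, mul_smul_comm]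
      exact P.sum_smul_gamma_gamma _ fun r s => P.christoffel_symm ν r s x
    have h2 : (2 : ℝ) • (∑ l, P.gInv x ν l • P.spinConn l x)
        = -∑ l, (P.gamma l x * P.gamma ν x + P.gamma ν x * P.gamma l x) * P.spinConn l x := by
      simp only [P.gamma_anticomm, Finset.smul_sum, smul_mul_assoc, one_mul, smul_smul,
        ← Finset.sum_neg_distrib, ← neg_smul, P.gInv_symm x ν]
      simp
    rw [← h1, h2, squareCoeffOne]
    simp only [P.matDeriv_gamma hx, diracZero, mul_sub, sub_mul, Finset.mul_sum, Finset.sum_mul,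
      add_mul, mul_neg, Finset.sum_sub_distrib, Finset.sum_neg_distrib, Finset.sum_add_distrib,
      mul_assoc]
    abel
  have h1 : ∑ ν, P.g x μ ν • ∑ l, P.gInv x ν l • P.spinConn l x = P.spinConn μ x := by
    have h2 : ∀ l, ∑ ν, P.g x μ ν * P.gInv x ν l = if μ = l then 1 else 0 := fun l => by
      have := congrFun (congrFun (P.g_mul_gInv hx) μ) l
      rwa [Matrix.mul_apply, Matrix.one_apply] at this
    simp only [Finset.smul_sum, smul_smul]
    rw [Finset.sum_comm]
    simp only [← Finset.sum_smul, h2, ite_smul, one_smul, zero_smul, Finset.sum_ite_eq,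
      Finset.mem_univ, if_true]
  have h3 : ∀ ν, A ν x + (∑ r, ∑ s, P.gInv x r s * P.christoffel ν r s x) • 1
      = (2 : ℝ) • (∑ l, P.gInv x ν l • P.spinConn l x)
        + (P.gamma ν x * Φ x + Φ x * P.gamma ν x) := fun ν => by
    rw [hA ν]; module
  rw [θ, squareConn]
  simp only [h3, smul_add (P.g x μ _), Finset.sum_add_distrib, smul_comm (P.g x μ _) (2 : ℝ),
    ← Finset.smul_sum, h1]
  module

end Square

end DiracPatch

/-! ### The antisymmetrized product of three Clifford generators. -/

section Triple

variable {𝒜 : Type*} [Ring 𝒜] [Algebra ℝ 𝒜]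

theorem sum_perm_fin_three {W : Type*} [AddCommGroup W] (f : Equiv.Perm (Fin 3) → W) :
    ∑ σ, f σ = f 1 + f (Equiv.swap 0 1) + f (Equiv.swap 0 2) + f (Equiv.swap 1 2)
      + f (Equiv.swap 0 1 * Equiv.swap 1 2) + f (Equiv.swap 1 2 * Equiv.swap 0 1) := by
  have h : (Finset.univ : Finset (Equiv.Perm (Fin 3))) = {1, Equiv.swap 0 1, Equiv.swap 0 2,
      Equiv.swap 1 2, Equiv.swap 0 1 * Equiv.swap 1 2, Equiv.swap 1 2 * Equiv.swap 0 1} := by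
    decide
  rw [h, Finset.sum_insert (by decide), Finset.sum_insert (by decide),
    Finset.sum_insert (by decide), Finset.sum_insert (by decide), Finset.sum_insert (by decide),
    Finset.sum_singleton]
  abel

/-- The antisymmetrized product of three elements. -/
def antisymm (p : Fin 3 → 𝒜) : 𝒜 :=
  ∑ σ : Equiv.Perm (Fin 3), ((Equiv.Perm.sign σ : ℤ) : ℝ) • (p (σ 0) * p (σ 1) * p (σ 2))

theorem antisymm_eq (p : Fin 3 → 𝒜) :
    antisymm p = p 0 * p 1 * p 2 - p 1 * p 0 * p 2 - p 2 * p 1 * p 0 - p 0 * p 2 * p 1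
      + p 1 * p 2 * p 0 + p 2 * p 0 * p 1 := by
  have e1 : Equiv.swap (0 : Fin 3) 1 2 = 2 := by decide
  have e2 : Equiv.swap (0 : Fin 3) 2 1 = 1 := by decide
  have e3 : Equiv.swap (1 : Fin 3) 2 0 = 0 := by decide
  have e4 : (0 : Fin 3) ≠ 1 := by decide
  have e5 : (0 : Fin 3) ≠ 2 := by decide
  have e6 : (1 : Fin 3) ≠ 2 := by decide
  rw [antisymm, sum_perm_fin_three]
  simp [e1, e2, e3, e4, e5, e6, sub_eq_add_neg]

variable {p : Fin 3 → 𝒜} {H : Matrix (Fin 3) (Fin 3) ℝ}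

/-- Sorting all six words into increasing order gives the same cubic term each time. The linear
terms are the price of generators that need not be orthogonal. -/
theorem antisymm_normal_form (hp : ∀ a b, p a * p b + p b * p a = (-2 * H a b) • (1 : 𝒜)) :
    antisymm p = (6 : ℝ) • (p 0 * (p 1 * p 2) + H 1 2 • p 0 - H 0 2 • p 1 + H 0 1 • p 2) := by
  have h1 : p 1 * p 0 = (-2 * H 0 1) • (1 : 𝒜) - p 0 * p 1 := by rw [← hp]; abel
  have h2 : p 2 * p 0 = (-2 * H 0 2) • (1 : 𝒜) - p 0 * p 2 := by rw [← hp]; abel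
  have h3 : p 2 * p 1 = (-2 * H 1 2) • (1 : 𝒜) - p 1 * p 2 := by rw [← hp]; abel
  -- The same exchange at the head of a longer word, needed because products are kept associated to
  -- the right.
  have h1' : ∀ z, p 1 * (p 0 * z) = (-2 * H 0 1) • z - p 0 * (p 1 * z) := fun z => by
    rw [← mul_assoc, h1, sub_mul, smul_one_mul, mul_assoc]
  rw [antisymm_eq]
  simp only [mul_assoc, h1, h2, h3, h1', mul_sub, sub_mul, mul_smul_comm,
    smul_mul_assoc, mul_one, one_mul]
  module

/-- In odd dimension the volume element is central: for orthogonal generators, `p a` changes sign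
past each of the two others and commutes with itself. In general both sides are reduced to sorted
words and compared. -/
theorem antisymm_comm (hp : ∀ a b, p a * p b + p b * p a = (-2 * H a b) • (1 : 𝒜)) (a : Fin 3) :
    antisymm p * p a = p a * antisymm p := by
  have h0 : ∀ a, p a * p a = (-H a a) • (1 : 𝒜) := fun a => by
    have := hp a a
    rw [← two_smul ℝ, neg_mul, ← mul_neg, mul_smul] at this
    exact smul_right_injective _ (two_ne_zero (α := ℝ)) this
  have h1 : p 1 * p 0 = (-2 * H 0 1) • (1 : 𝒜) - p 0 * p 1 := by rw [← hp]; abel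
  have h2 : p 2 * p 0 = (-2 * H 0 2) • (1 : 𝒜) - p 0 * p 2 := by rw [← hp]; abel
  have h3 : p 2 * p 1 = (-2 * H 1 2) • (1 : 𝒜) - p 1 * p 2 := by rw [← hp]; abel
  have h0' : ∀ a z, p a * (p a * z) = (-H a a) • z := fun a z => by
    rw [← mul_assoc, h0, smul_one_mul]
  have h1' : ∀ z, p 1 * (p 0 * z) = (-2 * H 0 1) • z - p 0 * (p 1 * z) := fun z => by
    rw [← mul_assoc, h1, sub_mul, smul_one_mul, mul_assoc]
  have h2' : ∀ z, p 2 * (p 0 * z) = (-2 * H 0 2) • z - p 0 * (p 2 * z) := fun z => by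
    rw [← mul_assoc, h2, sub_mul, smul_one_mul, mul_assoc]
  have h3' : ∀ z, p 2 * (p 1 * z) = (-2 * H 1 2) • z - p 1 * (p 2 * z) := fun z => by
    rw [← mul_assoc, h3, sub_mul, smul_one_mul, mul_assoc]
  rw [antisymm_normal_form hp]
  fin_cases a <;>
  · simp only [Fin.zero_eta, Fin.mk_one, Fin.reduceFinMk, mul_assoc, h0, h1, h2, h3, h0', h1', h2',
      h3', mul_sub, sub_mul, mul_add, add_mul, mul_smul_comm, smul_mul_assoc, mul_one]
    module

/-- For orthonormal generators of square `-1` the triple product squares to `+1`. In general its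
square is the Gram determinant, and `36 = 6²` comes from the sum over permutations. -/
theorem antisymm_sq (hp : ∀ a b, p a * p b + p b * p a = (-2 * H a b) • (1 : 𝒜))
    (hH : ∀ a b, H a b = H b a) : antisymm p * antisymm p = (36 * H.det) • (1 : 𝒜) := by
  have h0 : ∀ a, p a * p a = (-H a a) • (1 : 𝒜) := fun a => by
    have := hp a a
    rw [← two_smul ℝ, neg_mul, ← mul_neg, mul_smul] at this
    exact smul_right_injective _ (two_ne_zero (α := ℝ)) this
  have h1 : p 1 * p 0 = (-2 * H 0 1) • (1 : 𝒜) - p 0 * p 1 := by rw [← hp]; abel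
  have h2 : p 2 * p 0 = (-2 * H 0 2) • (1 : 𝒜) - p 0 * p 2 := by rw [← hp]; abel
  have h3 : p 2 * p 1 = (-2 * H 1 2) • (1 : 𝒜) - p 1 * p 2 := by rw [← hp]; abel
  have h0' : ∀ a z, p a * (p a * z) = (-H a a) • z := fun a z => by
    rw [← mul_assoc, h0, smul_one_mul]
  have h1' : ∀ z, p 1 * (p 0 * z) = (-2 * H 0 1) • z - p 0 * (p 1 * z) := fun z => by
    rw [← mul_assoc, h1, sub_mul, smul_one_mul, mul_assoc]
  have h2' : ∀ z, p 2 * (p 0 * z) = (-2 * H 0 2) • z - p 0 * (p 2 * z) := fun z => by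
    rw [← mul_assoc, h2, sub_mul, smul_one_mul, mul_assoc]
  have h3' : ∀ z, p 2 * (p 1 * z) = (-2 * H 1 2) • z - p 1 * (p 2 * z) := fun z => by
    rw [← mul_assoc, h3, sub_mul, smul_one_mul, mul_assoc]
  rw [antisymm_normal_form hp, Matrix.det_fin_three, hH 1 0, hH 2 0, hH 2 1]
  simp only [mul_assoc, h0, h1, h2, h3, h0', h1', h2',
      h3', mul_sub, sub_mul, mul_add, add_mul, mul_smul_comm, smul_mul_assoc, mul_one]
  module

theorem antisymm_anticomm_of {n : 𝒜} (hn : ∀ a, p a * n = -(n * p a)) :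
    antisymm p * n = -(n * antisymm p) := by
  simp only [antisymm, Finset.sum_mul, Finset.mul_sum, ← Finset.sum_neg_distrib]
  refine Finset.sum_congr rfl fun σ _ => ?_
  rw [smul_mul_assoc, mul_smul_comm, ← smul_neg, mul_assoc, hn, mul_neg, ← mul_assoc,
    mul_assoc (p _), hn, mul_neg, ← mul_assoc, hn]
  simp only [neg_mul, mul_assoc, neg_neg]

/-- Serves the uniqueness argument for the derivative of `χ`: what commutes with the tangential
gamma matrices commutes with `χ`. -/
theorem antisymm_comm_of {n : 𝒜} (hn : ∀ a, p a * n = n * p a) :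
    antisymm p * n = n * antisymm p := by
  simp only [antisymm, Finset.sum_mul, Finset.mul_sum]
  refine Finset.sum_congr rfl fun σ _ => ?_
  rw [smul_mul_assoc, mul_smul_comm, mul_assoc, hn, ← mul_assoc,
    mul_assoc (p _), hn, ← mul_assoc, hn]
  simp only [mul_assoc]

end Triple

/-! ### The boundary hypersurface: adapted basis, induced metric, second fundamental form. -/

namespace DiracPatch

variable {F : Type*} [Fintype F] [DecidableEq F] (P : DiracPatch F) {y : Fin 3 → ℝ}

theorem emb_mem_M (hy : y ∈ P.V) : P.emb y ∈ P.M := P.mapsTo_emb hy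

theorem uniqueDiff_V (hy : y ∈ P.V) : UniqueDiffWithinAt ℝ P.V y := P.uniqueDiffOn_V y hy

theorem contDiffOn_tangent (a : Fin 3) (μ : Fin 4) : ContDiffOn ℝ ∞ (P.tangent a μ) P.V :=
  contDiffOn_pi.1 (contDiffOn_pd P.uniqueDiffOn_V P.smooth_emb) μ

theorem differentiableWithinAt_emb (hy : y ∈ P.V) : DifferentiableWithinAt ℝ P.emb P.V y :=
  (P.smooth_emb y hy).differentiableWithinAt (by norm_num)

theorem contDiffOn_dρ (μ : Fin 4) : ContDiffOn ℝ ∞ (P.dρ μ) P.V :=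
  (contDiffOn_pd P.isOpen_Ω.uniqueDiffOn P.smooth_ρ).comp P.smooth_emb fun y hy => (P.emb_mem y hy).1

theorem dρ_tangent (hy : y ∈ P.V) (a : Fin 3) : ∑ μ, P.tangent a μ y * P.dρ μ y = 0 := by
  have h := pd_comp (s := P.Ω) (a := a) (f := P.ρ) (P.uniqueDiff_V hy)
    (P.differentiableAt_ρ (P.emb_mem y hy).1).differentiableWithinAt
    (P.differentiableWithinAt_emb hy) fun z hz => (P.emb_mem z hz).1
  have h0 : pd P.V a (fun z => P.ρ (P.emb z)) y = 0 := by
    rw [pd_congr (g := fun _ => 0) _ hy, pd_const]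
    filter_upwards [self_mem_nhdsWithin] with z hz using (P.emb_mem z hz).2
  rw [h0] at h
  exact h.symm

theorem exists_dρ_ne_zero (hy : y ∈ P.V) : (fun μ => P.dρ μ y) ≠ 0 := by
  intro h
  obtain ⟨h1, h2⟩ := P.emb_mem y hy
  refine P.regular_ρ _ h1 h2 (ContinuousLinearMap.ext fun v => ?_)
  rw [← fderivWithin_of_isOpen P.isOpen_Ω h1, fderivWithin_eq_sum_pd]
  have : ∀ μ, pd P.Ω μ P.ρ (P.emb y) = 0 := fun μ => congrFun h μ
  simp [this]

/-- The squared length of the gradient of the defining function. -/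
def gradSq (y : Fin 3 → ℝ) : ℝ := ∑ ν, ∑ r, P.gInv (P.emb y) ν r * P.dρ ν y * P.dρ r y

/-- In the orthonormal frame this is the Euclidean square of `e⁻¹ dρ`, and `dρ` does not vanish on
the boundary. -/
theorem gradSq_pos (hy : y ∈ P.V) : 0 < P.gradSq y := by
  have hx := P.emb_mem_M hy
  set u : Fin 4 → ℝ := fun μ => P.dρ μ y with hu
  set w := (P.e (P.emb y))⁻¹ *ᵥ u with hw
  have h1 : P.gradSq y = w ⬝ᵥ w := by
    have : P.gradSq y = u ⬝ᵥ (P.gInv (P.emb y) *ᵥ u) := by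
      simp only [gradSq, dotProduct, Matrix.mulVec, Finset.mul_sum, hu]
      exact Finset.sum_congr rfl fun _ _ => Finset.sum_congr rfl fun _ _ => by ring
    rw [this, P.gInv_eq, ← Matrix.mulVec_mulVec, ← hw, Matrix.dotProduct_mulVec,
      Matrix.vecMul_transpose]
  have h2 : w ≠ 0 := by
    intro h
    refine P.exists_dρ_ne_zero hy ?_
    have : P.e (P.emb y) *ᵥ w = u := by
      rw [hw, Matrix.mulVec_mulVec, P.e_mul_inv hx, Matrix.one_mulVec]
    rw [← hu, ← this, h, Matrix.mulVec_zero]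
  rw [h1]
  have h3 : 0 ≤ w ⬝ᵥ w := Finset.sum_nonneg fun _ _ => mul_self_nonneg _
  exact h3.lt_of_ne' fun h => h2 (dotProduct_self_eq_zero.1 h)

theorem contDiffOn_gradSq : ContDiffOn ℝ ∞ P.gradSq P.V :=
  ContDiffOn.sum fun ν _ => ContDiffOn.sum fun r _ =>
    (((P.smoothMat_gInv.comp P.smooth_emb P.mapsTo_emb) ν r).mul (P.contDiffOn_dρ ν)).mul
      (P.contDiffOn_dρ r)

theorem conormal_eq (hy : y ∈ P.V) (μ : Fin 4) : P.conormal μ y = P.dρ μ y / √(P.gradSq y) := by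
  have h : ∀ r, ∑ ν, P.g (P.emb y) μ ν * P.gInv (P.emb y) ν r = if μ = r then 1 else 0 := fun r => by
    have := congrFun (congrFun (P.g_mul_gInv (P.emb_mem_M hy)) μ) r
    rwa [Matrix.mul_apply, Matrix.one_apply] at this
  have h2 : P.conormal μ y = (∑ r, (∑ ν, P.g (P.emb y) μ ν * P.gInv (P.emb y) ν r) * P.dρ r y)
      / √(P.gradSq y) := by
    simp only [conormal, normal, gradSq, mul_div_assoc', ← Finset.sum_div, Finset.mul_sum,
      Finset.sum_mul]
    rw [Finset.sum_comm]; simp only [mul_assoc]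
  rw [h2]; simp [h]

theorem contDiffOn_conormal (μ : Fin 4) : ContDiffOn ℝ ∞ (P.conormal μ) P.V :=
  ((P.contDiffOn_dρ μ).div (P.contDiffOn_gradSq.sqrt fun _ hy => (P.gradSq_pos hy).ne')
    fun _ hy => (Real.sqrt_pos.2 (P.gradSq_pos hy)).ne').congr fun _ hy => P.conormal_eq hy μ

theorem conormal_tangent (hy : y ∈ P.V) (a : Fin 3) :
    ∑ μ, P.conormal μ y * P.tangent a μ y = 0 := by
  simp only [P.conormal_eq hy, div_mul_eq_mul_div, ← Finset.sum_div]
  simp only [mul_comm (P.dρ _ y), P.dρ_tangent hy, zero_div]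

theorem conormal_normal (hy : y ∈ P.V) : ∑ μ, P.conormal μ y * P.normal μ y = 1 := by
  have hp := P.gradSq_pos hy
  have : ∑ μ, P.conormal μ y * P.normal μ y = P.gradSq y / (√(P.gradSq y) * √(P.gradSq y)) := by
    simp only [P.conormal_eq hy, normal, div_mul_div_comm, ← Finset.sum_div, gradSq,
      Finset.mul_sum]
    congr 1
    exact Finset.sum_congr rfl fun _ _ => Finset.sum_congr rfl fun _ _ => by ring
  rw [this, Real.mul_self_sqrt hp.le, div_self hp.ne']

/-- The frame components of the tangent vectors of the boundary. -/
def frameTangent (y : Fin 3 → ℝ) : Matrix (Fin 4) (Fin 3) ℝ :=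
  (P.e (P.emb y))ᵀ * Matrix.of fun μ a => P.tangent a μ y

theorem h_eq (y : Fin 3 → ℝ) : P.h y = (P.frameTangent y)ᵀ * P.frameTangent y := by
  rw [frameTangent, Matrix.transpose_mul, Matrix.transpose_transpose, Matrix.mul_assoc,
    ← Matrix.mul_assoc (P.e _)]
  ext a b
  change _ = ((Matrix.of fun μ a => P.tangent a μ y)ᵀ * (P.g (P.emb y)
    * Matrix.of fun μ a => P.tangent a μ y)) a b
  simp only [h, Matrix.of_apply, Matrix.mul_apply (M := (Matrix.of fun μ a => P.tangent a μ y)ᵀ),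
    Matrix.mul_apply (M := P.g _), Matrix.transpose_apply, Finset.mul_sum]
  exact Finset.sum_congr rfl fun _ _ => Finset.sum_congr rfl fun _ _ => by ring

theorem tangent_sum_ne_zero (hy : y ∈ P.V) {c : Fin 3 → ℝ}
    (hc : (Matrix.of fun μ a => P.tangent a μ y) *ᵥ c = 0) : c = 0 := by
  refine P.immersion_emb y hy ?_
  rw [map_zero, ← fderivWithin_of_isOpen P.isOpen_V hy, fderivWithin_eq_sum_pd]
  ext μ
  have := congrFun hc μ
  simpa [Matrix.mulVec, dotProduct, tangent, mul_comm] using this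

/-- The induced metric is the Gram matrix of the frame components of the tangent vectors, which are
independent since the embedding is an immersion. -/
theorem h_posDef (hy : y ∈ P.V) : (P.h y).PosDef := by
  rw [h_eq, ← Matrix.conjTranspose_eq_transpose_of_trivial]
  refine Matrix.PosDef.conjTranspose_mul_self _ fun c d hcd => ?_
  rw [← sub_eq_zero]
  refine P.tangent_sum_ne_zero hy ?_
  have h1 : P.frameTangent y *ᵥ (c - d) = 0 := by
    rw [Matrix.mulVec_sub]; exact sub_eq_zero.2 hcd
  have h2 : ((P.e (P.emb y))⁻¹)ᵀ * (P.e (P.emb y))ᵀ = 1 := by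
    rw [← Matrix.transpose_mul, P.e_mul_inv (P.emb_mem_M hy), Matrix.transpose_one]
  have h3 := congrArg (((P.e (P.emb y))⁻¹)ᵀ *ᵥ ·) h1
  simpa only [frameTangent, Matrix.mulVec_mulVec, ← Matrix.mul_assoc, h2, Matrix.one_mul,
    Matrix.mulVec_zero] using h3

theorem h_det_pos (hy : y ∈ P.V) : 0 < (P.h y).det := (P.h_posDef hy).det_pos

theorem hInv_mul_h (hy : y ∈ P.V) : P.hInv y * P.h y = 1 :=
  Matrix.nonsing_inv_mul _ (P.h_det_pos hy).ne'.isUnit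

theorem h_mul_hInv (hy : y ∈ P.V) : P.h y * P.hInv y = 1 :=
  Matrix.mul_nonsing_inv _ (P.h_det_pos hy).ne'.isUnit

theorem hInv_symm (y : Fin 3 → ℝ) (a b : Fin 3) : P.hInv y a b = P.hInv y b a := by
  have h0 : (P.h y)ᵀ = P.h y := by rw [h_eq]; simp [Matrix.transpose_mul]
  have : (P.hInv y)ᵀ = P.hInv y := by rw [hInv, Matrix.transpose_nonsing_inv, h0]
  exact congrFun (congrFun this b) a

theorem smoothMat_h : SmoothMat P.V P.h := by
  intro a b
  simp only [h, Matrix.of_apply]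
  exact ContDiffOn.sum fun μ _ => ContDiffOn.sum fun ν _ =>
    (((P.smoothMat_g.comp P.smooth_emb P.mapsTo_emb) μ ν).mul (P.contDiffOn_tangent a μ)).mul
      (P.contDiffOn_tangent b ν)

theorem smoothMat_hInv : SmoothMat P.V P.hInv :=
  P.smoothMat_h.inv fun _ hy => (P.h_det_pos hy).ne'

theorem contDiffOn_cotangent (a : Fin 3) (μ : Fin 4) : ContDiffOn ℝ ∞ (P.cotangent a μ) P.V :=
  ContDiffOn.sum fun b _ => ContDiffOn.sum fun ν _ => ((P.smoothMat_hInv a b).mul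
    ((P.smoothMat_g.comp P.smooth_emb P.mapsTo_emb) μ ν)).mul (P.contDiffOn_tangent b ν)

theorem cotangent_tangent (hy : y ∈ P.V) (a b : Fin 3) :
    ∑ μ, P.cotangent a μ y * P.tangent b μ y = if a = b then 1 else 0 := by
  have h1 := congrFun (congrFun (P.hInv_mul_h hy) a) b
  rw [Matrix.mul_apply, Matrix.one_apply] at h1
  rw [← h1]
  simp only [cotangent, h, Matrix.of_apply, Finset.mul_sum, Finset.sum_mul]
  rw [Finset.sum_comm]
  refine Finset.sum_congr rfl fun c _ => ?_
  rw [Finset.sum_comm]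
  refine Finset.sum_congr rfl fun μ _ => Finset.sum_congr rfl fun ν _ => ?_
  rw [P.g_symm _ ν μ]; ring

theorem cotangent_normal (hy : y ∈ P.V) (a : Fin 3) :
    ∑ μ, P.cotangent a μ y * P.normal μ y = 0 := by
  have : ∑ μ, P.cotangent a μ y * P.normal μ y
      = ∑ b, P.hInv y a b * ∑ μ, P.conormal μ y * P.tangent b μ y := by
    simp only [cotangent, conormal, Finset.mul_sum, Finset.sum_mul]
    rw [Finset.sum_comm]
    refine Finset.sum_congr rfl fun b _ => ?_
    rw [Finset.sum_comm]
    refine Finset.sum_congr rfl fun μ _ => Finset.sum_congr rfl fun ν _ => ?_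
    rw [P.g_symm _ ν μ]; ring
  simp [this, P.conormal_tangent hy]

/-- The tangent vectors and the normal form a basis: completeness relation. -/
theorem completeness (hy : y ∈ P.V) (μ ν : Fin 4) :
    (∑ a, P.tangent a μ y * P.cotangent a ν y) + P.normal μ y * P.conormal ν y
      = if μ = ν then 1 else 0 := by
  let A : Matrix (Fin 4) (Fin 3 ⊕ Unit) ℝ :=
    Matrix.of fun μ j => Sum.elim (fun a => P.tangent a μ y) (fun _ => P.normal μ y) j
  let B : Matrix (Fin 3 ⊕ Unit) (Fin 4) ℝ :=
    Matrix.of fun j μ => Sum.elim (fun a => P.cotangent a μ y) (fun _ => P.conormal μ y) j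
  have hBA : B * A = 1 := by
    ext i j
    rw [Matrix.mul_apply, Matrix.one_apply]
    rcases i with a | _ <;> rcases j with b | _
    · simpa [A, B] using P.cotangent_tangent hy a b
    · simpa [A, B] using P.cotangent_normal hy a
    · simpa [A, B] using P.conormal_tangent hy b
    · simpa [A, B] using P.conormal_normal hy
  -- Duality of the two bases is `B * A = 1`; since `3 + 1 = 4`, a one-sided inverse is two-sided,
  -- and `A * B = 1` is completeness.
  have hAB : A * B = 1 := (Matrix.mul_eq_one_comm_of_card_eq _ _ _ (by simp)).1 hBA
  have := congrFun (congrFun hAB μ) ν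
  rw [Matrix.mul_apply, Matrix.one_apply, Fintype.sum_sum_type] at this
  simpa [A, B] using this

/-- Decomposition of a vector into its tangential and normal parts. -/
theorem vector_decomp (hy : y ∈ P.V) (X : Fin 4 → ℝ) (μ : Fin 4) :
    X μ = (∑ a, (∑ ν, P.cotangent a ν y * X ν) * P.tangent a μ y)
      + (∑ ν, P.conormal ν y * X ν) * P.normal μ y := by
  have : X μ = ∑ ν, ((∑ a, P.tangent a μ y * P.cotangent a ν y)
      + P.normal μ y * P.conormal ν y) * X ν := by
    simp [P.completeness hy]
  conv_lhs => rw [this]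
  simp only [add_mul, Finset.sum_add_distrib, Finset.sum_mul]
  congr 1
  · rw [Finset.sum_comm]
    exact Finset.sum_congr rfl fun _ _ => Finset.sum_congr rfl fun _ _ => by ring
  · exact Finset.sum_congr rfl fun _ _ => by ring

/-! The second fundamental form. -/

/-- The covariant derivative of the tangent vector `e_b` in the direction of `e_a`. -/
def tangentDeriv (a b : Fin 3) (y : Fin 3 → ℝ) (r : Fin 4) : ℝ :=
  pd P.V a (P.tangent b r) y
    + ∑ ν, ∑ μ, P.christoffel r ν μ (P.emb y) * P.tangent a ν y * P.tangent b μ y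

/-- Second partial derivatives of the embedding commute and the Levi-Civita connection is torsion
free. -/
theorem tangentDeriv_symm (hy : y ∈ P.V) (a b : Fin 3) (r : Fin 4) :
    P.tangentDeriv a b y r = P.tangentDeriv b a y r := by
  have hd : ∀ c, DifferentiableWithinAt ℝ (pd P.V c P.emb) P.V y := fun c =>
    (contDiffOn_pd P.uniqueDiffOn_V P.smooth_emb y hy).differentiableWithinAt (by norm_num)
  have h1 : ∀ a b, pd P.V a (P.tangent b r) y = pd P.V a (pd P.V b P.emb) y r :=
    fun a b => (pd_apply (P.uniqueDiff_V hy) (hd b) r).symm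
  have hc : y ∈ closure (interior P.V) := by
    rw [P.isOpen_V.interior_eq]; exact subset_closure hy
  rw [tangentDeriv, tangentDeriv, h1, h1, pd_comm P.uniqueDiffOn_V hc hy P.smooth_emb]
  congr 1
  rw [Finset.sum_comm]
  refine Finset.sum_congr rfl fun μ _ => Finset.sum_congr rfl fun ν _ => ?_
  rw [P.christoffel_symm]; ring

/-- Differentiating `n_μ e_a^μ = 0` along the boundary moves the derivative from the normal to the
tangent vector. Symmetry of `K` then follows from `tangentDeriv_symm`. -/
theorem K_eq (hy : y ∈ P.V) (a b : Fin 3) :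
    P.K a b y = ∑ r, P.conormal r y * P.tangentDeriv b a y r := by
  have hn : ∀ μ, DifferentiableWithinAt ℝ (P.conormal μ) P.V y := fun μ =>
    (P.contDiffOn_conormal μ y hy).differentiableWithinAt (by norm_num)
  have ht : ∀ μ, DifferentiableWithinAt ℝ (P.tangent a μ) P.V y := fun μ =>
    (P.contDiffOn_tangent a μ y hy).differentiableWithinAt (by norm_num)
  have h0 : pd P.V b (fun z => ∑ μ, P.conormal μ z * P.tangent a μ z) y = 0 := by
    rw [pd_congr (g := fun _ => 0) _ hy, pd_const]
    filter_upwards [self_mem_nhdsWithin] with z hz using P.conormal_tangent hz a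
  rw [pd_sum (P.uniqueDiff_V hy) _ fun μ _ => (hn μ).fun_mul (ht μ)] at h0
  simp only [pd_mul (P.uniqueDiff_V hy) (hn _) (ht _), Finset.sum_add_distrib] at h0
  have h2 : ∑ μ, (∑ ν, ∑ r, P.christoffel r μ ν (P.emb y) * P.conormal r y * P.tangent b ν y)
      * P.tangent a μ y = ∑ r, P.conormal r y *
        ∑ ν, ∑ μ, P.christoffel r ν μ (P.emb y) * P.tangent b ν y * P.tangent a μ y := by
    simp only [Finset.sum_mul, Finset.mul_sum]
    rw [Finset.sum_congr rfl fun μ _ => Finset.sum_comm, Finset.sum_comm]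
    refine Finset.sum_congr rfl fun r _ => ?_
    rw [Finset.sum_comm]
    refine Finset.sum_congr rfl fun ν _ => Finset.sum_congr rfl fun μ _ => ?_
    rw [P.christoffel_symm]; ring
  simp only [K, tangentDeriv, sub_mul, mul_add, Finset.sum_sub_distrib, Finset.sum_add_distrib, h2]
  linarith

theorem K_symm (hy : y ∈ P.V) (a b : Fin 3) : P.K a b y = P.K b a y := by
  rw [P.K_eq hy, P.K_eq hy]
  simp only [P.tangentDeriv_symm hy a b]

end DiracPatch

/-! ### Clifford algebra on the boundary and the covariant derivative of `χ`. -/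

namespace DiracPatch

variable {F : Type*} [Fintype F] [DecidableEq F] (P : DiracPatch F) {x : Fin 4 → ℝ} {y : Fin 3 → ℝ}

/-- Clifford multiplication by a vector with given frame components. -/
def flat : (Fin 4 → ℝ) →ₗ[ℝ] Matrix (Fin 4) (Fin 4) ℂ := Fintype.linearCombination ℝ P.γ

theorem flat_apply (v : Fin 4 → ℝ) : P.flat v = ∑ α, v α • P.γ α := rfl

theorem flat_anticomm (v w : Fin 4 → ℝ) :
    P.flat v * P.flat w + P.flat w * P.flat v = (-2 * (v ⬝ᵥ w)) • 1 := by
  have h : P.flat v * P.flat w + P.flat w * P.flat v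
      = ∑ α, ∑ β, (v α * w β) • (P.γ α * P.γ β + P.γ β * P.γ α) := by
    simp only [flat_apply, Finset.sum_mul_sum, smul_add, Finset.sum_add_distrib, smul_mul_smul_comm]
    congr 1
    rw [Finset.sum_comm]
    simp only [mul_comm (w _)]
  have h2 : ∀ α β, P.γ α * P.γ β + P.γ β * P.γ α = (if α = β then (-2 : ℝ) else 0) • 1 :=
    fun α β => by rw [P.γ_mul_comm]; abel
  rw [h]
  simp only [h2, smul_ite, ite_smul, zero_smul, smul_smul, Finset.sum_ite_eq,
    Finset.mem_univ, if_true, smul_zero, dotProduct, Finset.mul_sum, Finset.sum_smul]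
  simp only [mul_comm (-2 : ℝ)]

theorem sum_smul_spinorGamma (u : Fin 4 → ℝ) :
    ∑ μ, u μ • P.spinorGamma μ x = P.flat ((P.e x)⁻¹ *ᵥ u) := by
  simp only [spinorGamma, flat_apply, Matrix.mulVec, dotProduct, eInv, Finset.smul_sum, smul_smul,
    Finset.sum_smul]
  rw [Finset.sum_comm]
  simp only [mul_comm]

/-- `γ_μ X^μ` on the spinor space. -/
def lowered (x : Fin 4 → ℝ) : (Fin 4 → ℝ) →ₗ[ℝ] Matrix (Fin 4) (Fin 4) ℂ :=
  P.flat ∘ₗ Matrix.mulVecLin (P.e x)ᵀ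

theorem lowered_apply (X : Fin 4 → ℝ) : P.lowered x X = P.flat ((P.e x)ᵀ *ᵥ X) := rfl

theorem sum_spinorGamma_g (hx : x ∈ P.M) (X : Fin 4 → ℝ) :
    ∑ μ, (∑ ν, P.g x μ ν * X ν) • P.spinorGamma μ x = P.lowered x X := by
  have : (fun μ => ∑ ν, P.g x μ ν * X ν) = P.g x *ᵥ X := rfl
  rw [P.sum_smul_spinorGamma (fun μ => ∑ ν, P.g x μ ν * X ν), this, g, Matrix.mulVec_mulVec,
    ← Matrix.mul_assoc, P.inv_mul_e hx, Matrix.one_mul, lowered_apply]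

/-- Covectors and vectors anticommute up to their natural pairing, with no metric left over. The
boundary Clifford relations follow by inserting the dual bases. -/
theorem spinorGamma_lowered_anticomm (hx : x ∈ P.M) (u X : Fin 4 → ℝ) :
    (∑ μ, u μ • P.spinorGamma μ x) * P.lowered x X + P.lowered x X * ∑ μ, u μ • P.spinorGamma μ x
      = (-2 * ∑ μ, u μ * X μ) • 1 := by
  rw [P.sum_smul_spinorGamma, lowered_apply, flat_anticomm, Matrix.dotProduct_mulVec,
    Matrix.vecMul_transpose, Matrix.mulVec_mulVec, P.e_mul_inv hx, Matrix.one_mulVec]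
  rfl

/-- `γ_n` on the spinor space. -/
def spinorGammaN (y : Fin 3 → ℝ) : Matrix (Fin 4) (Fin 4) ℂ :=
  ∑ μ, P.conormal μ y • P.spinorGamma μ (P.emb y)

/-- `γ_a = γ_μ e_a^μ` on the spinor space. -/
def spinorGammaLower (a : Fin 3) (y : Fin 3 → ℝ) : Matrix (Fin 4) (Fin 4) ℂ :=
  P.lowered (P.emb y) fun μ => P.tangent a μ y

theorem spinorGammaN_eq (hy : y ∈ P.V) :
    P.spinorGammaN y = P.lowered (P.emb y) fun μ => P.normal μ y :=
  P.sum_spinorGamma_g (P.emb_mem_M hy) _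

theorem spinorGammaT_eq (hy : y ∈ P.V) (a : Fin 3) :
    P.spinorGammaT a y = ∑ b, P.hInv y a b • P.spinorGammaLower b y := by
  simp only [spinorGammaLower, ← map_smul, ← map_sum]
  rw [← P.sum_spinorGamma_g (P.emb_mem_M hy), spinorGammaT]
  refine Finset.sum_congr rfl fun μ _ => ?_
  congr 1
  simp only [cotangent, Finset.sum_apply, Pi.smul_apply, smul_eq_mul, Finset.mul_sum]
  rw [Finset.sum_comm]
  exact Finset.sum_congr rfl fun _ _ => Finset.sum_congr rfl fun _ _ => by ring

theorem spinorGammaLower_eq (hy : y ∈ P.V) (a : Fin 3) :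
    P.spinorGammaLower a y = ∑ b, P.h y a b • P.spinorGammaT b y := by
  have h : ∀ c, ∑ b, P.h y a b * P.hInv y b c = if a = c then 1 else 0 := fun c => by
    have := congrFun (congrFun (P.h_mul_hInv hy) a) c
    rwa [Matrix.mul_apply, Matrix.one_apply] at this
  simp only [P.spinorGammaT_eq hy, Finset.smul_sum, smul_smul]
  rw [Finset.sum_comm]
  simp [← Finset.sum_smul, h]

theorem spinorGammaT_lower_anticomm (hy : y ∈ P.V) (a b : Fin 3) :
    P.spinorGammaT a y * P.spinorGammaLower b y + P.spinorGammaLower b y * P.spinorGammaT a y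
      = (if a = b then (-2 : ℝ) else 0) • 1 := by
  have := P.spinorGamma_lowered_anticomm (P.emb_mem_M hy) (fun μ => P.cotangent a μ y)
    fun μ => P.tangent b μ y
  rw [P.cotangent_tangent hy, mul_ite, mul_one, mul_zero] at this
  exact this

theorem spinorGammaT_anticomm (hy : y ∈ P.V) (a b : Fin 3) :
    P.spinorGammaT a y * P.spinorGammaT b y + P.spinorGammaT b y * P.spinorGammaT a y
      = (-2 * P.hInv y a b) • 1 := by
  rw [P.spinorGammaT_eq hy b]
  simp only [Finset.mul_sum, Finset.sum_mul, ← Finset.sum_add_distrib, smul_mul_assoc,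
    mul_smul_comm, ← smul_add, P.spinorGammaT_lower_anticomm hy]
  simp [P.hInv_symm y b a, smul_smul, mul_comm]

theorem spinorGammaN_sq (hy : y ∈ P.V) : P.spinorGammaN y * P.spinorGammaN y = -1 := by
  have := P.spinorGamma_lowered_anticomm (P.emb_mem_M hy) (fun μ => P.conormal μ y)
    fun μ => P.normal μ y
  rw [P.conormal_normal hy, ← P.spinorGammaN_eq hy] at this
  change P.spinorGammaN y * P.spinorGammaN y + P.spinorGammaN y * P.spinorGammaN y = _ at this
  rw [← two_smul ℝ, mul_one, ← neg_one_mul, mul_comm, mul_smul] at this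
  rw [smul_right_injective _ (two_ne_zero (α := ℝ)) this]
  simp

theorem spinorGammaT_mul_N (hy : y ∈ P.V) (a : Fin 3) :
    P.spinorGammaT a y * P.spinorGammaN y = -(P.spinorGammaN y * P.spinorGammaT a y) := by
  have := P.spinorGamma_lowered_anticomm (P.emb_mem_M hy) (fun μ => P.cotangent a μ y)
    fun μ => P.normal μ y
  rw [P.cotangent_normal hy, ← P.spinorGammaN_eq hy, mul_zero, zero_smul] at this
  exact eq_neg_of_add_eq_zero_left this

theorem spinorGammaLower_mul_N (hy : y ∈ P.V) (a : Fin 3) :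
    P.spinorGammaLower a y * P.spinorGammaN y = -(P.spinorGammaN y * P.spinorGammaLower a y) := by
  simp only [P.spinorGammaLower_eq hy, Finset.sum_mul, Finset.mul_sum, smul_mul_assoc,
    mul_smul_comm, P.spinorGammaT_mul_N hy, smul_neg, Finset.sum_neg_distrib]

/-- `χ` on the spinor space. -/
def spinorChi (y : Fin 3 → ℝ) : Matrix (Fin 4) (Fin 4) ℂ :=
  -(√(P.h y).det / 6) • antisymm fun a => P.spinorGammaT a y

theorem χ_eq (y : Fin 3 → ℝ) : P.χ y = P.spinorChi y ⊗ₖ (1 : Matrix F F ℂ) := rfl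

/-- The `γ^a` have Gram matrix `h^{ab}`, so the factor `√h / 6` cancels both `det h⁻¹` and `36`. -/
theorem spinorChi_sq (hy : y ∈ P.V) : P.spinorChi y * P.spinorChi y = 1 := by
  have hd := P.h_det_pos hy
  rw [spinorChi, smul_mul_smul_comm, antisymm_sq (P.spinorGammaT_anticomm hy) (P.hInv_symm y),
    smul_smul]
  have h1 : (P.hInv y).det * (P.h y).det = 1 := by
    rw [← Matrix.det_mul, P.hInv_mul_h hy, Matrix.det_one]
  have h2 := Real.mul_self_sqrt hd.le
  have : -(√(P.h y).det / 6) * -(√(P.h y).det / 6) * (36 * (P.hInv y).det) = 1 := by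
    rw [← h1]; linear_combination (P.hInv y).det * h2
  rw [this, one_smul]

theorem spinorChi_mul_T (hy : y ∈ P.V) (a : Fin 3) :
    P.spinorChi y * P.spinorGammaT a y = P.spinorGammaT a y * P.spinorChi y := by
  rw [spinorChi, smul_mul_assoc, mul_smul_comm, antisymm_comm (P.spinorGammaT_anticomm hy)]

theorem spinorChi_mul_lower (hy : y ∈ P.V) (a : Fin 3) :
    P.spinorChi y * P.spinorGammaLower a y = P.spinorGammaLower a y * P.spinorChi y := by
  simp only [P.spinorGammaLower_eq hy, Finset.sum_mul, Finset.mul_sum, smul_mul_assoc,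
    mul_smul_comm, P.spinorChi_mul_T hy]

theorem spinorChi_mul_N (hy : y ∈ P.V) :
    P.spinorChi y * P.spinorGammaN y = -(P.spinorGammaN y * P.spinorChi y) := by
  rw [spinorChi, smul_mul_assoc, mul_smul_comm, antisymm_anticomm_of (P.spinorGammaT_mul_N hy),
    smul_neg]

theorem smoothMat_spinorGammaT (a : Fin 3) : SmoothMat P.V (P.spinorGammaT a) :=
  SmoothMat.sum _ fun μ => SmoothMat.smul (P.contDiffOn_cotangent a μ)
    ((P.smoothMat_spinorGamma μ).comp P.smooth_emb P.mapsTo_emb)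

theorem smoothMat_spinorChi : SmoothMat P.V P.spinorChi := by
  refine SmoothMat.smul (((contDiffOn_det P.smoothMat_h).sqrt
    fun y hy => (P.h_det_pos hy).ne').div_const 6).neg (SmoothMat.sum _ fun σ => ?_)
  exact SmoothMat.smul contDiffOn_const (((P.smoothMat_spinorGammaT _).mul
    (P.smoothMat_spinorGammaT _)).mul (P.smoothMat_spinorGammaT _))

theorem smoothMat_χ : SmoothMat P.V P.χ := P.smoothMat_spinorChi.kronecker _

/-! Covariant derivatives along the boundary. -/

/-- The tangential part of the spin connection on the spinor space. -/
def spinorConnT (a : Fin 3) (y : Fin 3 → ℝ) : Matrix (Fin 4) (Fin 4) ℂ :=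
  ∑ μ, P.tangent a μ y • P.spinorConn μ (P.emb y)

/-- The covariant derivative `∂_a X + [ω_a, X]` along the boundary on the spinor space. -/
def spinorCov (a : Fin 3) (X : (Fin 3 → ℝ) → Matrix (Fin 4) (Fin 4) ℂ) (y : Fin 3 → ℝ) :
    Matrix (Fin 4) (Fin 4) ℂ :=
  matDeriv P.V a X y + (P.spinorConnT a y * X y - X y * P.spinorConnT a y)

theorem spinorCov_mul (hy : y ∈ P.V) (a : Fin 3) {X Y : (Fin 3 → ℝ) → Matrix (Fin 4) (Fin 4) ℂ}
    (hX : SmoothMat P.V X) (hY : SmoothMat P.V Y) :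
    P.spinorCov a (fun z => X z * Y z) y = P.spinorCov a X y * Y y + X y * P.spinorCov a Y y := by
  rw [spinorCov, matDeriv_mul (P.uniqueDiff_V hy) (hX.diffMat hy) (hY.diffMat hy), spinorCov,
    spinorCov]
  noncomm_ring

theorem spinorCov_congr (hy : y ∈ P.V) (a : Fin 3) {X Y : (Fin 3 → ℝ) → Matrix (Fin 4) (Fin 4) ℂ}
    (h : ∀ z ∈ P.V, X z = Y z) : P.spinorCov a X y = P.spinorCov a Y y := by
  rw [spinorCov, spinorCov, h y hy, matDeriv_congr (B := Y) _ hy]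
  filter_upwards [self_mem_nhdsWithin] with z hz using h z hz

theorem contDiffOn_frameTangent (α : Fin 4) (b : Fin 3) :
    ContDiffOn ℝ ∞ (fun z => P.frameTangent z α b) P.V := by
  simp only [frameTangent, Matrix.mul_apply, Matrix.of_apply, Matrix.transpose_apply]
  exact ContDiffOn.sum fun μ _ => ((P.smoothMat_e.comp P.smooth_emb P.mapsTo_emb) μ α).mul
    (P.contDiffOn_tangent b μ)

theorem spinorGammaLower_eq_frame (b : Fin 3) :
    P.spinorGammaLower b = fun z => ∑ α, P.frameTangent z α b • P.γ α := rfl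

theorem smoothMat_spinorGammaLower (b : Fin 3) : SmoothMat P.V (P.spinorGammaLower b) := by
  rw [spinorGammaLower_eq_frame]
  exact SmoothMat.sum _ fun α => SmoothMat.smul (P.contDiffOn_frameTangent α b) (smoothMat_const _)

/-- The tangential part of the matrix of coefficients of the spin connection. -/
def spinCoeffMatT (a : Fin 3) (y : Fin 3 → ℝ) : Matrix (Fin 4) (Fin 4) ℝ :=
  ∑ μ, P.tangent a μ y • P.spinCoeffMat μ (P.emb y)

theorem commutator_spinorConnT (hy : y ∈ P.V) (a : Fin 3) (v : Fin 4 → ℝ) :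
    P.spinorConnT a y * P.flat v - P.flat v * P.spinorConnT a y
      = P.flat (P.spinCoeffMatT a y *ᵥ v) := by
  have hx := P.emb_mem_M hy
  have h : P.spinorConnT a y * P.flat v - P.flat v * P.spinorConnT a y
      = ∑ μ, ∑ δ, (P.tangent a μ y * v δ) • (P.spinorConn μ (P.emb y) * P.γ δ
        - P.γ δ * P.spinorConn μ (P.emb y)) := by
    simp only [spinorConnT, flat_apply, Finset.sum_mul_sum, smul_mul_smul_comm, smul_sub,
      Finset.sum_sub_distrib]
    congr 1
    rw [Finset.sum_comm]
    simp only [mul_comm (v _)]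
  rw [h]
  simp only [P.commutator_spinorConn hx, flat_apply, spinCoeffMatT, Matrix.mulVec, dotProduct,
    Matrix.sum_apply, Matrix.smul_apply, P.spinCoeffMat_apply, smul_eq_mul, Finset.smul_sum,
    smul_smul, Finset.sum_mul, Finset.sum_smul]
  rw [Finset.sum_congr rfl fun μ _ => Finset.sum_comm, Finset.sum_comm]
  refine Finset.sum_congr rfl fun β _ => ?_
  rw [Finset.sum_comm]
  refine Finset.sum_congr rfl fun δ _ => Finset.sum_congr rfl fun μ _ => ?_
  congr 1; ring

/-- In `∂e = e ω + Γ e` along the boundary, the `Γ` terms complete `∂_a e_b` to the covariant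
derivative and the `ω` terms rotate the frame components. -/
theorem pd_frameTangent (hy : y ∈ P.V) (a b : Fin 3) :
    (fun α => pd P.V a (fun z => P.frameTangent z α b) y)
      = (P.spinCoeffMatT a y)ᵀ *ᵥ (fun α => P.frameTangent y α b)
        + (P.e (P.emb y))ᵀ *ᵥ P.tangentDeriv a b y := by
  have hx := P.emb_mem_M hy
  ext α
  have he : ∀ μ, DifferentiableWithinAt ℝ (fun z => P.e (P.emb z) μ α) P.V y := fun μ =>
    (P.smoothMat_e.comp P.smooth_emb P.mapsTo_emb).diffMat hy μ α
  have ht : ∀ μ, DifferentiableWithinAt ℝ (P.tangent b μ) P.V y := fun μ =>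
    (P.contDiffOn_tangent b μ y hy).differentiableWithinAt (by norm_num)
  have h1 : pd P.V a (fun z => P.frameTangent z α b) y
      = ∑ μ, (pd P.V a (fun z => P.e (P.emb z) μ α) y * P.tangent b μ y
        + P.e (P.emb y) μ α * pd P.V a (P.tangent b μ) y) := by
    simp only [frameTangent, Matrix.mul_apply, Matrix.of_apply, Matrix.transpose_apply]
    rw [pd_sum (P.uniqueDiff_V hy) _ fun μ _ => (he μ).fun_mul (ht μ)]
    exact Finset.sum_congr rfl fun μ _ => pd_mul (P.uniqueDiff_V hy) (he μ) (ht μ)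
  have h2 : ∀ μ, pd P.V a (fun z => P.e (P.emb z) μ α) y
      = ∑ ν, P.tangent a ν y * ((P.e (P.emb y) * P.spinCoeffMat ν (P.emb y)) μ α
        + (P.christoffelMat ν (P.emb y) * P.e (P.emb y)) μ α) := by
    intro μ
    rw [pd_comp (f := fun z => P.e z μ α) (P.uniqueDiff_V hy) (P.smoothMat_e.diffMat hx μ α)
      (P.differentiableWithinAt_emb hy) P.mapsTo_emb]
    refine Finset.sum_congr rfl fun ν _ => ?_
    rw [← Matrix.add_apply, P.e_mul_spinCoeffMat hx, sub_add_cancel]; rfl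
  rw [h1]
  simp only [h2, Matrix.mul_apply, christoffelMat, Matrix.of_apply, Pi.add_apply, Matrix.mulVec,
    dotProduct, Matrix.transpose_apply, spinCoeffMatT, Matrix.sum_apply, Matrix.smul_apply,
    smul_eq_mul, frameTangent, tangentDeriv, mul_add, add_mul, Finset.sum_add_distrib,
    Finset.mul_sum, Finset.sum_mul]
  rw [add_assoc, add_comm (∑ μ, P.e (P.emb y) μ α * _)]
  congr 1
  · rw [Finset.sum_congr rfl fun μ _ => Finset.sum_comm, Finset.sum_comm]
    exact Finset.sum_congr rfl fun _ _ => Finset.sum_congr rfl fun _ _ =>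
      Finset.sum_congr rfl fun _ _ => by ring
  · congr 1
    rw [Finset.sum_congr rfl fun μ _ => Finset.sum_comm, Finset.sum_comm]
    refine Finset.sum_congr rfl fun r _ => ?_
    rw [Finset.sum_comm]
    exact Finset.sum_congr rfl fun _ _ => Finset.sum_congr rfl fun _ _ => by ring

/-- Clifford multiplication is parallel: the frame rotation `ωᵀ` from the derivative cancels `ω`
from the commutator by antisymmetry. -/
theorem spinorCov_lower (hy : y ∈ P.V) (a b : Fin 3) :
    P.spinorCov a (P.spinorGammaLower b) y
      = P.lowered (P.emb y) (P.tangentDeriv a b y) := by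
  have h1 : matDeriv P.V a (P.spinorGammaLower b) y
      = P.flat fun α => pd P.V a (fun z => P.frameTangent z α b) y := by
    rw [spinorGammaLower_eq_frame]
    exact matDeriv_sum_smul_const (P.uniqueDiff_V hy) _ _ fun α =>
      (P.contDiffOn_frameTangent α b y hy).differentiableWithinAt (by norm_num)
  have h2 : P.spinorGammaLower b y = P.flat fun α => P.frameTangent y α b := rfl
  have h3 : (P.spinCoeffMatT a y)ᵀ + P.spinCoeffMatT a y = 0 := by
    simp only [spinCoeffMatT, Matrix.transpose_sum, Matrix.transpose_smul,
      ← Finset.sum_add_distrib, ← smul_add]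
    simp only [add_comm _ (P.spinCoeffMat _ _), P.spinCoeffMat_antisymm (P.emb_mem_M hy)]
    simp
  rw [spinorCov, h1, h2, P.commutator_spinorConnT hy, P.pd_frameTangent hy, ← map_add,
    add_right_comm, ← Matrix.add_mulVec, h3, Matrix.zero_mulVec, zero_add, lowered_apply]

/-- The Gauss formula under Clifford multiplication. The tangential coefficients need no evaluation,
since that part commutes with `χ`. -/
theorem spinorCov_lower_decomp (hy : y ∈ P.V) (a b : Fin 3) :
    P.spinorCov a (P.spinorGammaLower b) y
      = (∑ c, (∑ ν, P.cotangent c ν y * P.tangentDeriv a b y ν) • P.spinorGammaLower c y)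
        + P.K a b y • P.spinorGammaN y := by
  rw [P.spinorCov_lower hy, P.spinorGammaN_eq hy, P.K_symm hy, P.K_eq hy]
  simp only [spinorGammaLower, ← map_smul, ← map_sum, ← map_add]
  congr 1
  ext μ
  simpa using P.vector_decomp hy (P.tangentDeriv a b y) μ

/-- Both sides anticommute with `χ` and have the same commutators with every `γ_b`. Their difference
therefore commutes with all tangential gamma matrices, hence with `χ`, but also anticommutes with
`χ`; as `χ` is invertible, it vanishes. -/
theorem spinorCov_chi (hy : y ∈ P.V) (a : Fin 3) : P.spinorCov a P.spinorChi y
    = ∑ b, P.K a b y • (P.spinorChi y * P.spinorGammaN y * P.spinorGammaT b y) := by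
  have hχs := P.smoothMat_spinorChi
  set X := P.spinorChi y with hX
  set N := P.spinorGammaN y with hN
  set D := P.spinorCov a P.spinorChi y with hD
  have hXX : X * X = 1 := P.spinorChi_sq hy
  have hXN : X * N = -(N * X) := P.spinorChi_mul_N hy
  have hDX : D * X + X * D = 0 := by
    rw [hD, hX, ← P.spinorCov_mul hy a hχs hχs,
      P.spinorCov_congr hy a (Y := fun _ => 1) fun z hz => P.spinorChi_sq hz, spinorCov,
      matDeriv_const]
    simp
  -- The derivative of `[χ, γ_b] = 0`: the tangential part of the Gauss formula drops out, and the
  -- normal part gives `K_{ab} (γ_n χ - χ γ_n) = -2 K_{ab} χ γ_n`.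
  have hDT : ∀ b, D * P.spinorGammaLower b y - P.spinorGammaLower b y * D
      = (-2 * P.K a b y) • (X * N) := by
    intro b
    have h1 := P.spinorCov_congr hy a fun z hz => P.spinorChi_mul_lower hz b
    rw [P.spinorCov_mul hy a hχs (P.smoothMat_spinorGammaLower b),
      P.spinorCov_mul hy a (P.smoothMat_spinorGammaLower b) hχs, P.spinorCov_lower_decomp hy,
      ← hX, ← hD, ← hN] at h1
    have h2 : X * (∑ c, (∑ ν, P.cotangent c ν y * P.tangentDeriv a b y ν) • P.spinorGammaLower c y)
        = (∑ c, (∑ ν, P.cotangent c ν y * P.tangentDeriv a b y ν) • P.spinorGammaLower c y) * X := by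
      simp only [Finset.mul_sum, Finset.sum_mul, mul_smul_comm, smul_mul_assoc, hX,
        P.spinorChi_mul_lower hy]
    rw [mul_add, add_mul, h2, mul_smul_comm, smul_mul_assoc, eq_neg_of_add_eq_zero_right
      (show X * N + N * X = 0 by rw [hXN]; abel)] at h1
    have h3 := sub_eq_zero.2 h1
    rw [← sub_eq_zero, ← h3]; module
  have hYT : ∀ b, (∑ c, P.K a c y • (X * N * P.spinorGammaT c y)) * P.spinorGammaLower b y
      - P.spinorGammaLower b y * (∑ c, P.K a c y • (X * N * P.spinorGammaT c y))
      = (-2 * P.K a b y) • (X * N) := by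
    intro b
    have h1 : P.spinorGammaLower b y * (X * N) = -(X * N * P.spinorGammaLower b y) := by
      rw [← mul_assoc, hX, ← P.spinorChi_mul_lower hy, mul_assoc, P.spinorGammaLower_mul_N hy,
        mul_neg, mul_assoc]
    have h2 : ∀ c, P.spinorGammaLower b y * (X * N * P.spinorGammaT c y)
        = -(X * N * (P.spinorGammaLower b y * P.spinorGammaT c y)) := fun c => by
      rw [← mul_assoc, h1, neg_mul, mul_assoc _ (P.spinorGammaLower b y)]
    simp only [Finset.sum_mul, Finset.mul_sum, ← Finset.sum_sub_distrib, smul_mul_assoc,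
      mul_smul_comm, h2, ← smul_sub, sub_neg_eq_add, mul_assoc (X * N), ← mul_add,
      P.spinorGammaT_lower_anticomm hy]
    simp [smul_smul, mul_comm]
  have hYX : (∑ c, P.K a c y • (X * N * P.spinorGammaT c y)) * X
      = -(X * ∑ c, P.K a c y • (X * N * P.spinorGammaT c y)) := by
    simp only [Finset.sum_mul, Finset.mul_sum, smul_mul_assoc, mul_smul_comm,
      ← Finset.sum_neg_distrib, ← smul_neg]
    refine Finset.sum_congr rfl fun c _ => ?_
    rw [mul_assoc, hX, ← P.spinorChi_mul_T hy, ← hX, mul_assoc, ← mul_assoc N,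
      eq_neg_of_add_eq_zero_right (show X * N + N * X = 0 by rw [hXN]; abel)]
    simp only [neg_mul, mul_neg, mul_assoc]
  set Y := ∑ c, P.K a c y • (X * N * P.spinorGammaT c y)
  have hZT : ∀ b, P.spinorGammaT b y * (D - Y) = (D - Y) * P.spinorGammaT b y := by
    have h : ∀ b, P.spinorGammaLower b y * (D - Y) = (D - Y) * P.spinorGammaLower b y := fun b => by
      have := (hDT b).trans (hYT b).symm
      rw [mul_sub, sub_mul]
      rw [sub_eq_sub_iff_add_eq_add] at this ⊢
      rw [add_comm, ← this.symm, add_comm]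
    intro b
    simp only [P.spinorGammaT_eq hy, Finset.sum_mul, Finset.mul_sum, smul_mul_assoc,
      mul_smul_comm, h]
  have hZX : X * (D - Y) = (D - Y) * X := by
    rw [hX, spinorChi, smul_mul_assoc, mul_smul_comm, antisymm_comm_of hZT]
  have hZX' : (D - Y) * X = -(X * (D - Y)) := by
    rw [sub_mul, hYX, eq_neg_of_add_eq_zero_left hDX]; noncomm_ring
  have h0 : (2 : ℝ) • ((D - Y) * X) = 0 := by
    rw [two_smul]; nth_rw 2 [hZX']; rw [hZX, add_neg_cancel]
  have h1 : (D - Y) * X = 0 := (smul_eq_zero.1 h0).resolve_left two_ne_zero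
  have h2 : D - Y = 0 := by
    rw [← mul_one (D - Y), ← hXX, ← mul_assoc, h1, zero_mul]
  exact sub_eq_zero.1 h2

end DiracPatch

/-! ### Boundary conditions and the Robin term on the full fibre. -/

namespace DiracPatch

variable {F : Type*} [Fintype F] [DecidableEq F] (P : DiracPatch F) {x : Fin 4 → ℝ} {y : Fin 3 → ℝ}

/-! Boundary identities on `ℂ⁴ ⊗ ℂ^F`. -/

theorem gammaN_eq (y : Fin 3 → ℝ) : P.gammaN y = P.spinorGammaN y ⊗ₖ P.γF := by
  ext p q
  simp only [gammaN, spinorGammaN, gamma, Matrix.kroneckerMap_apply, Matrix.sum_apply,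
    Matrix.smul_apply, Finset.sum_mul, smul_mul_assoc]

theorem gammaT_eq (a : Fin 3) (y : Fin 3 → ℝ) : P.gammaT a y = P.spinorGammaT a y ⊗ₖ P.γF := by
  ext p q
  simp only [gammaT, spinorGammaT, gamma, Matrix.kroneckerMap_apply, Matrix.sum_apply,
    Matrix.smul_apply, Finset.sum_mul, smul_mul_assoc]

theorem neg_kronecker {ι κ : Type*} (A : Matrix ι ι ℂ) (B : Matrix κ κ ℂ) :
    (-A) ⊗ₖ B = -(A ⊗ₖ B) := by
  ext p q; simp

theorem χ_sq (hy : y ∈ P.V) : P.χ y * P.χ y = 1 := by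
  rw [χ_eq, ← Matrix.mul_kronecker_mul, P.spinorChi_sq hy, one_mul, Matrix.one_kronecker_one]

theorem χ_mul_gammaT (hy : y ∈ P.V) (a : Fin 3) : P.χ y * P.gammaT a y = P.gammaT a y * P.χ y := by
  rw [χ_eq, gammaT_eq, ← Matrix.mul_kronecker_mul, ← Matrix.mul_kronecker_mul,
    P.spinorChi_mul_T hy, one_mul, mul_one]

theorem χ_mul_gammaN (hy : y ∈ P.V) : P.χ y * P.gammaN y = -(P.gammaN y * P.χ y) := by
  rw [χ_eq, gammaN_eq, ← Matrix.mul_kronecker_mul, ← Matrix.mul_kronecker_mul,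
    P.spinorChi_mul_N hy, one_mul, mul_one, neg_kronecker]

theorem gammaN_sq (hy : y ∈ P.V) : P.gammaN y * P.gammaN y = -1 := by
  rw [gammaN_eq, ← Matrix.mul_kronecker_mul, P.spinorGammaN_sq hy, P.γF_sq, neg_kronecker,
    Matrix.one_kronecker_one]

theorem gammaT_mul_gammaN (hy : y ∈ P.V) (a : Fin 3) :
    P.gammaT a y * P.gammaN y = -(P.gammaN y * P.gammaT a y) := by
  rw [gammaN_eq, gammaT_eq, ← Matrix.mul_kronecker_mul, ← Matrix.mul_kronecker_mul,
    P.spinorGammaT_mul_N hy, neg_kronecker]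

theorem gammaT_anticomm (hy : y ∈ P.V) (a b : Fin 3) :
    P.gammaT a y * P.gammaT b y + P.gammaT b y * P.gammaT a y = (-2 * P.hInv y a b) • 1 := by
  rw [gammaT_eq, gammaT_eq, ← Matrix.mul_kronecker_mul, ← Matrix.mul_kronecker_mul, P.γF_sq,
    ← Matrix.add_kronecker, P.spinorGammaT_anticomm hy, Matrix.smul_kronecker,
    Matrix.one_kronecker_one]

theorem χ_mul_one_kronecker (B : Matrix F F ℂ) :
    P.χ y * ((1 : Matrix (Fin 4) (Fin 4) ℂ) ⊗ₖ B) = (1 : Matrix (Fin 4) (Fin 4) ℂ) ⊗ₖ B * P.χ y := by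
  rw [χ_eq, ← Matrix.mul_kronecker_mul, ← Matrix.mul_kronecker_mul, one_mul, mul_one, one_mul,
    mul_one]

theorem gamma_decomp (hy : y ∈ P.V) (μ : Fin 4) : P.gamma μ (P.emb y)
    = (∑ a, P.tangent a μ y • P.gammaT a y) + P.normal μ y • P.gammaN y := by
  have : P.gamma μ (P.emb y) = ∑ ν, ((∑ a, P.tangent a μ y * P.cotangent a ν y)
      + P.normal μ y * P.conormal ν y) • P.gamma ν (P.emb y) := by
    simp [P.completeness hy]
  rw [this]
  simp only [add_smul, Finset.sum_add_distrib, Finset.sum_smul, gammaT, gammaN, Finset.smul_sum,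
    smul_smul]
  rw [Finset.sum_comm]

theorem projP_eq (y : Fin 3 → ℝ) : P.projP y = (1 / 2 : ℝ) • (1 + P.χ y) := by
  rw [projP, projM]; module

section Boundary

variable (A : Fin 4 → (Fin 4 → ℝ) → Matrix (Fin 4 × F) (Fin 4 × F) ℂ)

theorem tangentialPart_spinConn (a : Fin 3) (y : Fin 3 → ℝ) :
    P.tangentialPart P.spinConn a y = P.spinorConnT a y ⊗ₖ (1 : Matrix F F ℂ) := by
  ext p q
  simp only [tangentialPart, spinorConnT, spinConn_eq, Matrix.kroneckerMap_apply, Matrix.sum_apply,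
    Matrix.smul_apply, Finset.sum_mul, smul_mul_assoc]

/-- The spinor identity tensored with the identity: the two factors `γF` in `γ^n γ^b` cancel.
Replacing `ω` by `ω' = ω + θ` adds the commutator. -/
theorem covχ_eq (hy : y ∈ P.V) (a : Fin 3) : P.covχ A a y =
    (∑ b, P.K a b y • (P.χ y * P.gammaN y * P.gammaT b y))
      + (P.tangentialPart (P.θ A) a y * P.χ y - P.χ y * P.tangentialPart (P.θ A) a y) := by
  have h1 : P.tangentialPart (P.squareConn A) a y
      = P.spinorConnT a y ⊗ₖ (1 : Matrix F F ℂ) + P.tangentialPart (P.θ A) a y := by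
    rw [← tangentialPart_spinConn]
    simp only [tangentialPart, θ, ← Finset.sum_add_distrib, ← smul_add]
    simp
  have h2 : pdMat P.V a P.χ y = matDeriv P.V a P.spinorChi y ⊗ₖ (1 : Matrix F F ℂ) :=
    matDeriv_kronecker (P.uniqueDiff_V hy) (P.smoothMat_spinorChi.diffMat hy) _
  have h3 : ∑ b, P.K a b y • (P.χ y * P.gammaN y * P.gammaT b y)
      = P.spinorCov a P.spinorChi y ⊗ₖ (1 : Matrix F F ℂ) := by
    rw [P.spinorCov_chi hy]
    ext p q
    simp only [χ_eq, gammaN_eq, gammaT_eq, ← Matrix.mul_kronecker_mul, one_mul, P.γF_sq,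
      Matrix.kroneckerMap_apply, Matrix.sum_apply, Matrix.smul_apply, Finset.sum_mul,
      smul_mul_assoc]
  have h4 : P.spinorCov a P.spinorChi y ⊗ₖ (1 : Matrix F F ℂ)
      = matDeriv P.V a P.spinorChi y ⊗ₖ (1 : Matrix F F ℂ)
        + ((P.spinorConnT a y ⊗ₖ (1 : Matrix F F ℂ)) * P.χ y
          - P.χ y * (P.spinorConnT a y ⊗ₖ (1 : Matrix F F ℂ))) := by
    rw [χ_eq, ← Matrix.mul_kronecker_mul, ← Matrix.mul_kronecker_mul]
    ext p q
    simp [spinorCov, add_mul, sub_mul]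
  rw [h3, h4, covχ, h1, h2]
  noncomm_ring

theorem dirac_eq_primed (Φ : (Fin 4 → ℝ) → Matrix (Fin 4 × F) (Fin 4 × F) ℂ)
    (Ψ : (Fin 4 → ℝ) → (Fin 4 × F → ℂ)) (x : Fin 4 → ℝ) :
    P.dirac Φ Ψ x = P.diracOp (P.squareConn A) (P.primedPotential A Φ) Ψ x := by
  have h : ∀ μ, P.squareConn A μ x = P.spinConn μ x + P.θ A μ x := fun μ => by rw [θ]; abel
  simp only [dirac, diracOp, cov, primedPotential, h, Matrix.mulVec_add, Matrix.add_mulVec,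
    Matrix.sum_mulVec, Matrix.mulVec_mulVec, Finset.sum_add_distrib]
  abel

variable {A}

theorem mulVec_projM_eq_zero_iff {v : Fin 4 × F → ℂ} : P.projM y *ᵥ v = 0 ↔ P.χ y *ᵥ v = v := by
  rw [projM, smul_mulVec_real, Matrix.sub_mulVec, Matrix.one_mulVec,
    smul_eq_zero_iff_right (by norm_num), sub_eq_zero, eq_comm]

/-- On a field satisfying the Dirichlet condition, `(1 - χ) ∇'_a Ψ = (∇'_a χ) Ψ`. -/
theorem χ_mulVec_cov {Ψ : (Fin 4 → ℝ) → (Fin 4 × F → ℂ)} (hΨ : P.SmoothSpinor Ψ)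
    (hD : ∀ z ∈ P.V, P.χ z *ᵥ Ψ (P.emb z) = Ψ (P.emb z)) (hy : y ∈ P.V) (a : Fin 3) :
    P.χ y *ᵥ (∑ μ, P.tangent a μ y • P.cov (P.squareConn A) μ Ψ (P.emb y))
      = (∑ μ, P.tangent a μ y • P.cov (P.squareConn A) μ Ψ (P.emb y))
        - P.covχ A a y *ᵥ Ψ (P.emb y) := by
  have hΨ' : DifferentiableWithinAt ℝ Ψ P.M (P.emb y) :=
    (hΨ _ (P.emb_mem_M hy)).differentiableWithinAt (by norm_num)
  have hψ : DifferentiableWithinAt ℝ (fun z => Ψ (P.emb z)) P.V y :=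
    hΨ'.comp y (P.differentiableWithinAt_emb hy) P.mapsTo_emb
  have h1 : ∑ μ, P.tangent a μ y • P.cov (P.squareConn A) μ Ψ (P.emb y)
      = pd P.V a (fun z => Ψ (P.emb z)) y
        + P.tangentialPart (P.squareConn A) a y *ᵥ Ψ (P.emb y) := by
    rw [pd_comp (P.uniqueDiff_V hy) hΨ' (P.differentiableWithinAt_emb hy) P.mapsTo_emb]
    simp only [cov, smul_add, Finset.sum_add_distrib, tangentialPart, Matrix.sum_mulVec,
      smul_mulVec_real]
    rfl
  -- The Dirichlet condition `ψ = χ ψ` holds along the whole boundary, so it may be differentiated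
  -- tangentially.
  have h2 : pd P.V a (fun z => Ψ (P.emb z)) y = pdMat P.V a P.χ y *ᵥ Ψ (P.emb y)
      + P.χ y *ᵥ pd P.V a (fun z => Ψ (P.emb z)) y := by
    rw [pdMat_eq_matDeriv, ← pd_mulVec (P.uniqueDiff_V hy) (P.smoothMat_χ.diffMat hy) hψ]
    refine pd_congr ?_ hy
    filter_upwards [self_mem_nhdsWithin] with z hz using (hD z hz).symm
  rw [h1, covχ]
  simp only [Matrix.mulVec_add, Matrix.add_mulVec, Matrix.sub_mulVec, ← Matrix.mulVec_mulVec,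
    hD y hy]
  nth_rw 2 [h2]
  abel

/-- `Π_+ (∇'_n Π_+) Π_+ = 0`: the normal derivative does not see the extension of `χ`. -/
theorem projP_mulVec_covN {Ψ : (Fin 4 → ℝ) → (Fin 4 × F → ℂ)} (hΨ : P.SmoothSpinor Ψ)
    (hy : y ∈ P.V) (hD : P.χ y *ᵥ Ψ (P.emb y) = Ψ (P.emb y))
    {X : (Fin 4 → ℝ) → Matrix (Fin 4 × F) (Fin 4 × F) ℂ} (hX : P.IsExtensionAt y X) :
    P.projP y *ᵥ P.covN A (fun x => ((1 / 2 : ℝ) • (1 + X x)) *ᵥ Ψ x) y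
      = P.projP y *ᵥ P.covN A Ψ y := by
  obtain ⟨⟨U, hU, hyU, hXs, hXX⟩, hχ⟩ := hX
  have hxM := P.emb_mem_M hy
  have hX0 : X (P.emb y) = P.χ y := hχ.self_of_nhds
  have hs := P.uniqueDiffOn_M _ hxM
  have hΨ' : DifferentiableWithinAt ℝ Ψ P.M (P.emb y) :=
    (hΨ _ hxM).differentiableWithinAt (by norm_num)
  have hXd : DiffMat P.M X (P.emb y) := fun p q =>
    (differentiableWithinAt_inter (hU.mem_nhds hyU)).1 (hXs.diffMat ⟨hxM, hyU⟩ p q)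
  have hdX : ∀ μ, matDeriv P.M μ X (P.emb y) * P.χ y + P.χ y * matDeriv P.M μ X (P.emb y) = 0 := by
    intro μ
    rw [← hX0, ← matDeriv_mul hs hXd hXd, matDeriv_congr (B := fun _ => 1) _ hxM, matDeriv_const]
    filter_upwards [self_mem_nhdsWithin, mem_nhdsWithin_of_mem_nhds (hU.mem_nhds hyU)] with z h1 h2
      using hXX z ⟨h1, h2⟩
  have hQ : DiffMat P.M (fun x => (1 / 2 : ℝ) • (1 + X x)) (P.emb y) := fun p q =>
    (((differentiableWithinAt_const _).add (hXd p q)).const_smul (1 / 2 : ℝ))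
  have hdQ : ∀ μ, matDeriv P.M μ (fun x => (1 / 2 : ℝ) • (1 + X x)) (P.emb y)
      = (1 / 2 : ℝ) • matDeriv P.M μ X (P.emb y) := by
    intro μ
    ext p q
    simp only [matDeriv, Matrix.of_apply, Matrix.smul_apply, Matrix.add_apply]
    have h1 := pd_smul (i := μ) hs (differentiableWithinAt_const (1 / 2 : ℝ))
      ((hXd p q).const_add ((1 : Matrix (Fin 4 × F) (Fin 4 × F) ℂ) p q))
    have h2 := pd_add (i := μ) hs
      (differentiableWithinAt_const ((1 : Matrix (Fin 4 × F) (Fin 4 × F) ℂ) p q)) (hXd p q)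
    rw [pd_const, zero_smul, add_zero] at h1
    rw [pd_const, zero_add] at h2
    exact h1.trans (congrArg _ h2)
  have hone : ((1 / 2 : ℝ) • (1 + P.χ y)) *ᵥ Ψ (P.emb y) = Ψ (P.emb y) := by
    rw [smul_mulVec_real, Matrix.add_mulVec, hD, Matrix.one_mulVec]; module
  have hPP : P.projP y * ((1 / 2 : ℝ) • (1 + P.χ y)) = P.projP y := by
    rw [projP_eq, smul_mul_smul_comm, mul_add, add_mul, add_mul, P.χ_sq hy]
    simp only [mul_one, one_mul]; module
  -- Since `X² = 1`, the derivative of `X` anticommutes with `χ`. It maps `Ψ` from the `+1`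
  -- eigenspace into the `-1` eigenspace, which `Π_+` kills.
  have hPX : ∀ μ, P.projP y *ᵥ (matDeriv P.M μ X (P.emb y) *ᵥ Ψ (P.emb y)) = 0 := by
    intro μ
    have h : P.χ y *ᵥ (matDeriv P.M μ X (P.emb y) *ᵥ Ψ (P.emb y))
        = -(matDeriv P.M μ X (P.emb y) *ᵥ Ψ (P.emb y)) := by
      rw [Matrix.mulVec_mulVec, eq_neg_of_add_eq_zero_right (hdX μ), Matrix.neg_mulVec,
        ← Matrix.mulVec_mulVec, hD]
    rw [projP_eq, smul_mulVec_real, Matrix.add_mulVec, h, Matrix.one_mulVec, add_neg_cancel,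
      smul_zero]
  simp only [covN, Matrix.mulVec_sum]
  refine Finset.sum_congr rfl fun μ _ => ?_
  rw [Matrix.mulVec_smul, Matrix.mulVec_smul]
  congr 1
  rw [cov, cov, pd_mulVec hs hQ hΨ', hdQ, hX0, hone, Matrix.mulVec_add, Matrix.mulVec_add,
    Matrix.mulVec_add, smul_mulVec_real, Matrix.mulVec_smul, hPX, smul_zero, zero_add,
    Matrix.mulVec_mulVec, hPP]

/-- Given the Dirichlet condition, `γ_n (1 - χ) D Ψ` and the Robin expression are both multiples of
one vector `E`, by `-1` and by `1/2`; so they vanish together. -/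
theorem squareBC_iff {Φ : (Fin 4 → ℝ) → Matrix (Fin 4 × F) (Fin 4 × F) ℂ}
    {X : (Fin 3 → ℝ) → (Fin 4 → ℝ) → Matrix (Fin 4 × F) (Fin 4 × F) ℂ}
    (hX : ∀ y ∈ P.V, P.IsExtensionAt y (X y)) {Ψ : (Fin 4 → ℝ) → (Fin 4 × F → ℂ)}
    (hΨ : P.SmoothSpinor Ψ) :
    P.SquareBC Φ Ψ ↔
      ∀ y ∈ P.V, P.mixedOp A (P.robin A (P.primedPotential A Φ)) (X y) Ψ y = 0 := by
  have key : P.DirichletBC Ψ → ∀ y ∈ P.V, (P.projM y *ᵥ P.dirac Φ Ψ (P.emb y) = 0 ↔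
      P.projP y *ᵥ (P.covN A (fun x => ((1 / 2 : ℝ) • (1 + X y x)) *ᵥ Ψ x) y
        + P.robin A (P.primedPotential A Φ) y *ᵥ (P.projP y *ᵥ Ψ (P.emb y))) = 0) := by
    intro hD y hy
    have hD' : ∀ z ∈ P.V, P.χ z *ᵥ Ψ (P.emb z) = Ψ (P.emb z) := fun z hz =>
      P.mulVec_projM_eq_zero_iff.1 (hD z hz)
    set ψ := Ψ (P.emb y) with hψ
    set N := P.gammaN y with hN
    set S := P.χ y with hS
    set n := P.covN A Ψ y with hn
    set Φ' := P.primedPotential A Φ (P.emb y) with hΦ'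
    set c : Fin 3 → (Fin 4 × F → ℂ) :=
      fun a => ∑ μ, P.tangent a μ y • P.cov (P.squareConn A) μ Ψ (P.emb y) with hc
    set q : Fin 3 → (Fin 4 × F → ℂ) := fun a => P.covχ A a y *ᵥ ψ with hq
    have hSψ : S *ᵥ ψ = ψ := hD' y hy
    have hSS : S * S = 1 := P.χ_sq hy
    have hSc : ∀ a, S *ᵥ c a = c a - q a := fun a => P.χ_mulVec_cov hΨ hD' hy a
    -- The vector `q a = (1 - χ) c a` lies in the `-1` eigenspace.
    have hSq : ∀ a, S *ᵥ q a = -q a := fun a => by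
      have h : q a = c a - S *ᵥ c a := by rw [hSc]; abel
      rw [h, Matrix.mulVec_sub, Matrix.mulVec_mulVec, hSS, Matrix.one_mulVec]; abel
    have hNN : N * N = -1 := P.gammaN_sq hy
    have hSN : S * N = -(N * S) := P.χ_mul_gammaN hy
    have hNS : N * S = -(S * N) := by rw [hSN, neg_neg]
    have hd : P.dirac Φ Ψ (P.emb y) = (∑ a, P.gammaT a y *ᵥ c a) + N *ᵥ n - Φ' *ᵥ ψ := by
      rw [P.dirac_eq_primed A, diracOp]
      congr 1
      simp only [P.gamma_decomp hy, Matrix.add_mulVec, Matrix.sum_mulVec, smul_mulVec_real,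
        Finset.sum_add_distrib, hc, hn, covN, Matrix.mulVec_sum, Matrix.mulVec_smul]
      rw [Finset.sum_comm]
    set d := P.dirac Φ Ψ (P.emb y) with hdd
    set E := n + S *ᵥ n + (N * Φ') *ᵥ ψ + (S * (N * Φ')) *ᵥ ψ
      - ∑ a, (N * P.gammaT a y) *ᵥ q a with hE
    have hSd : S *ᵥ d = (∑ a, P.gammaT a y *ᵥ (c a - q a)) - (N * S) *ᵥ n - (S * Φ') *ᵥ ψ := by
      rw [hd, Matrix.mulVec_sub, Matrix.mulVec_add, Matrix.mulVec_sum, Matrix.mulVec_mulVec n S N,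
        hSN, Matrix.neg_mulVec, Matrix.mulVec_mulVec ψ S Φ', ← sub_eq_add_neg]
      simp only [Matrix.mulVec_mulVec, hS, P.χ_mul_gammaT hy]
      simp only [← Matrix.mulVec_mulVec, ← hS, hSc]
    have hNSΦ : N * S * Φ' = -(S * N * Φ') := by rw [hNS, neg_mul]
    -- As `χ` commutes with `γ^a`, the tangential derivatives enter only through `c - χ c = q`. The
    -- sign changes of `χ` past `γ^n` produce `1 + χ` in front of the normal derivative.
    have h1 : N *ᵥ (d - S *ᵥ d) = -E := by
      rw [hSd, hd]
      simp only [Matrix.mulVec_sub, Matrix.mulVec_add, Matrix.mulVec_sum, Matrix.mulVec_mulVec,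
        Finset.sum_sub_distrib, ← Matrix.mul_assoc, hNN, hNSΦ, hE, Matrix.neg_mulVec, neg_mul,
        Matrix.one_mulVec, Matrix.one_mul]
      abel
    have h2 : P.projP y *ᵥ (P.covN A (fun x => ((1 / 2 : ℝ) • (1 + X y x)) *ᵥ Ψ x) y
        + P.robin A (P.primedPotential A Φ) y *ᵥ (P.projP y *ᵥ ψ)) = (1 / 2 : ℝ) • E := by
      have hPψ : P.projP y *ᵥ ψ = ψ := by
        rw [projP_eq, smul_mulVec_real, Matrix.add_mulVec, ← hS, hSψ, Matrix.one_mulVec]; module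
      have hPP : P.projP y * P.projP y = P.projP y := by
        rw [projP_eq, smul_mul_smul_comm, mul_add, add_mul, add_mul, P.χ_sq hy]
        simp only [mul_one, one_mul]; module
      -- `γ^a` preserves the eigenspaces of `χ` and `γ_n` exchanges them, so these vectors lie in
      -- the `+1` eigenspace and the outer projections of `S` act trivially on them.
      have hPq : P.projP y *ᵥ (∑ a, (N * P.gammaT a y) *ᵥ q a) = ∑ a, (N * P.gammaT a y) *ᵥ q a := by
        have : S *ᵥ (∑ a, (N * P.gammaT a y) *ᵥ q a) = ∑ a, (N * P.gammaT a y) *ᵥ q a := by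
          rw [Matrix.mulVec_sum]
          refine Finset.sum_congr rfl fun a _ => ?_
          rw [Matrix.mulVec_mulVec, ← mul_assoc, hSN, neg_mul, mul_assoc, hS, P.χ_mul_gammaT hy,
            ← hS, ← mul_assoc, Matrix.neg_mulVec, ← Matrix.mulVec_mulVec, hSq, Matrix.mulVec_neg,
            neg_neg]
        rw [projP_eq, smul_mulVec_real, Matrix.add_mulVec, ← hS, this, Matrix.one_mulVec]; module
      have hR : P.projP y *ᵥ (P.robin A (P.primedPotential A Φ) y *ᵥ (P.projP y *ᵥ ψ))
          = P.projP y *ᵥ ((N * Φ') *ᵥ ψ) - (1 / 2 : ℝ) • ∑ a, (N * P.gammaT a y) *ᵥ q a := by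
        rw [hPψ, robin, ← Matrix.mulVec_mulVec, hPψ, Matrix.mulVec_mulVec, ← mul_assoc, hPP,
          ← Matrix.mulVec_mulVec, Matrix.sub_mulVec, Matrix.mulVec_sub, smul_mulVec_real,
          Matrix.mulVec_smul, Matrix.sum_mulVec]
        simp only [← Matrix.mulVec_mulVec _ _ (P.covχ A _ y)]
        rw [hPq]
      rw [Matrix.mulVec_add, P.projP_mulVec_covN hΨ hy hSψ (hX y hy), hR, ← hn, projP_eq, ← hS,
        smul_mulVec_real, smul_mulVec_real, Matrix.add_mulVec, Matrix.add_mulVec,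
        Matrix.mulVec_mulVec _ S, Matrix.one_mulVec, Matrix.one_mulVec, hE]
      module
    rw [P.mulVec_projM_eq_zero_iff, h2, smul_eq_zero_iff_right (by norm_num), ← hS]
    constructor
    · intro h
      rw [h, sub_self, Matrix.mulVec_zero] at h1
      exact neg_eq_zero.1 h1.symm
    · intro h
      -- Because `γ_n² = -1`, multiplication by `γ_n` loses no information.
      have h3 : N *ᵥ (N *ᵥ (d - S *ᵥ d)) = 0 := by rw [h1, h, neg_zero, Matrix.mulVec_zero]
      rw [Matrix.mulVec_mulVec, hNN, Matrix.neg_mulVec, Matrix.one_mulVec, neg_eq_zero,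
        sub_eq_zero] at h3
      exact h3.symm
  constructor
  · rintro ⟨h1, h2⟩ y hy
    exact Prod.ext (h1 y hy) ((key h1 y hy).1 (h2 y hy))
  · intro h
    have h1 : P.DirichletBC Ψ := fun y hy => congrArg Prod.fst (h y hy)
    exact ⟨h1, fun y hy => (key h1 y hy).2 (congrArg Prod.snd (h y hy))⟩

/-- The Robin term if `θ` commutes with `χ` and `γ_n Φ` anticommutes with `χ`. -/
theorem robin_eq (hy : y ∈ P.V) {Φ : (Fin 4 → ℝ) → Matrix (Fin 4 × F) (Fin 4 × F) ℂ}
    (hθ : ∀ a, P.tangentialPart (P.θ A) a y * P.χ y = P.χ y * P.tangentialPart (P.θ A) a y)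
    (hΦ : P.gammaN y * Φ (P.emb y) * P.χ y = -(P.χ y * (P.gammaN y * Φ (P.emb y)))) :
    P.robin A Φ y = (-(P.trK y / 2)) • P.projP y := by
  set S := P.χ y with hS
  set N := P.gammaN y with hN
  have hSS : S * S = 1 := P.χ_sq hy
  have hNN : N * N = -1 := P.gammaN_sq hy
  have hNS : N * S = -(S * N) := by rw [hS, P.χ_mul_gammaN hy, neg_neg]
  have h1 : ∀ a b, N * P.gammaT a y * (S * N * P.gammaT b y)
      = -(S * (P.gammaT a y * P.gammaT b y)) := fun a b => by
    calc N * P.gammaT a y * (S * N * P.gammaT b y)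
        = N * (P.gammaT a y * S) * N * P.gammaT b y := by simp only [mul_assoc]
      _ = (N * S) * (P.gammaT a y * N) * P.gammaT b y := by
        rw [hS, ← P.χ_mul_gammaT hy]; simp only [mul_assoc]
      _ = S * (N * N) * P.gammaT a y * P.gammaT b y := by
        rw [hNS, hN, P.gammaT_mul_gammaN hy]; simp only [mul_assoc, neg_mul, mul_neg, neg_neg]
      _ = _ := by rw [hNN]; simp only [mul_assoc, neg_mul, mul_neg, mul_one]
  -- Since `K` is symmetric, only `{γ^a, γ^b} = -2 h^{ab}` contributes, which produces the trace.
  have h2 : ∑ a, ∑ b, P.K a b y • (P.gammaT a y * P.gammaT b y)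
      = (-P.trK y) • (1 : Matrix (Fin 4 × F) (Fin 4 × F) ℂ) := by
    have h : ∑ a, ∑ b, P.K a b y • (P.gammaT a y * P.gammaT b y)
        = ∑ a, ∑ b, P.K a b y • (P.gammaT b y * P.gammaT a y) := by
      rw [Finset.sum_comm]
      exact Finset.sum_congr rfl fun a _ => Finset.sum_congr rfl fun b _ => by rw [P.K_symm hy]
    have h' : (2 : ℝ) • ∑ a, ∑ b, P.K a b y • (P.gammaT a y * P.gammaT b y)
        = (2 : ℝ) • ((-P.trK y) • (1 : Matrix (Fin 4 × F) (Fin 4 × F) ℂ)) := by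
      rw [two_smul]
      nth_rw 2 [h]
      simp only [← Finset.sum_add_distrib, ← smul_add, P.gammaT_anticomm hy, smul_smul,
        ← Finset.sum_smul]
      congr 1
      simp only [trK, mul_neg, Finset.mul_sum, ← Finset.sum_neg_distrib]
      exact Finset.sum_congr rfl fun a _ => Finset.sum_congr rfl fun b _ => by ring
    exact smul_right_injective _ (two_ne_zero (α := ℝ)) h'
  have h3 : ∑ a, N * P.gammaT a y * P.covχ A a y = P.trK y • S := by
    calc ∑ a, N * P.gammaT a y * P.covχ A a y
        = -(S * ∑ a, ∑ b, P.K a b y • (P.gammaT a y * P.gammaT b y)) := by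
          simp only [P.covχ_eq A hy, ← hS, ← hN, hθ, sub_self, add_zero, Finset.mul_sum,
            mul_smul_comm, h1, smul_neg, Finset.sum_neg_distrib]
      _ = _ := by rw [h2]; simp
  rw [robin, ← hN, h3, projP_eq, ← hS]
  set G := N * Φ (P.emb y)
  -- An operator anticommuting with `χ` is off-diagonal in the splitting of the fibre, so its `Π_+`
  -- block vanishes.
  have h4 : (1 + S) * G * (1 + S) = 0 := by
    have : S * G * S = -G := by
      rw [mul_assoc, hΦ, mul_neg, ← mul_assoc, hSS, one_mul]
    have h : (1 + S) * G * (1 + S) = G + G * S + S * G + S * G * S := by noncomm_ring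
    rw [h, hΦ, this]; abel
  have h5 : (1 + S) * S * (1 + S) = (2 : ℝ) • (1 + S) := by
    have h : (1 + S) * S * (1 + S) = S + S * S + S * S + S * S * S := by noncomm_ring
    rw [h, hSS, one_mul]; module
  simp only [smul_mul_assoc, mul_smul_comm, mul_sub, sub_mul, h4, h5, smul_sub]
  module

end Boundary

/-! Extension of `χ` off the boundary. -/

/-- With `L` a linear left inverse of the derivative of the embedding at `y`, the map `f = L ∘ emb`
is a local diffeomorphism. Then `χ ∘ f⁻¹ ∘ L` extends `χ` constantly along the fibres of `L`, so its
values remain involutions. -/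
theorem exists_extension (hy : y ∈ P.V) : ∃ X, P.IsExtensionAt y X := by
  have hemb : ∀ {z}, z ∈ P.V → ContDiffAt ℝ ∞ P.emb z := fun hz =>
    P.smooth_emb.contDiffAt (P.isOpen_V.mem_nhds hz)
  obtain ⟨L₀, hL₀⟩ := LinearMap.exists_leftInverse_of_injective
    (fderiv ℝ P.emb y : (Fin 3 → ℝ) →ₗ[ℝ] (Fin 4 → ℝ)) (LinearMap.ker_eq_bot.2 (P.immersion_emb y hy))
  let L : (Fin 4 → ℝ) →L[ℝ] (Fin 3 → ℝ) := LinearMap.toContinuousLinearMap L₀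
  let f : (Fin 3 → ℝ) → (Fin 3 → ℝ) := fun z => L (P.emb z)
  have hf : ∀ {z}, z ∈ P.V → ContDiffAt ℝ ∞ f z := fun hz => L.contDiff.contDiffAt.comp _ (hemb hz)
  have hf' : HasFDerivAt f
      ((ContinuousLinearEquiv.refl ℝ (Fin 3 → ℝ) : (Fin 3 → ℝ) ≃L[ℝ] (Fin 3 → ℝ)) :
        (Fin 3 → ℝ) →L[ℝ] (Fin 3 → ℝ)) y := by
    have h := L.hasFDerivAt.comp y ((hemb hy).differentiableAt (by norm_num)).hasFDerivAt
    have e : L.comp (fderiv ℝ P.emb y) = ((ContinuousLinearEquiv.refl ℝ (Fin 3 → ℝ) :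
        (Fin 3 → ℝ) ≃L[ℝ] (Fin 3 → ℝ)) : (Fin 3 → ℝ) →L[ℝ] (Fin 3 → ℝ)) := by
      ext1 v
      exact LinearMap.congr_fun hL₀ v
    rwa [e] at h
  let φ := (hf hy).toOpenPartialHomeomorph f hf' (by norm_num)
  have hφ : ∀ z, φ z = f z := fun z => rfl
  have hyφ : y ∈ φ.source := (hf hy).mem_toOpenPartialHomeomorph_source hf' (by norm_num)
  let R : Set ((Fin 3 → ℝ) →L[ℝ] (Fin 3 → ℝ)) :=
    Set.range ((↑) : ((Fin 3 → ℝ) ≃L[ℝ] (Fin 3 → ℝ)) → ((Fin 3 → ℝ) →L[ℝ] (Fin 3 → ℝ)))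
  have hR : IsOpen R := ContinuousLinearEquiv.isOpen
  -- The local inverse is needed to be smooth on a whole neighbourhood, so the points are restricted
  -- to the open set where the derivative of `f` stays invertible.
  let T : Set (Fin 3 → ℝ) := P.V ∩ fderiv ℝ f ⁻¹' R
  have hT : IsOpen T := by
    have hfV : ContDiffOn ℝ ∞ f P.V := fun z hz => (hf hz).contDiffWithinAt
    exact (hfV.continuousOn_fderiv_of_isOpen P.isOpen_V (by norm_num)).isOpen_inter_preimage
      P.isOpen_V hR
  have hyT : y ∈ T := ⟨hy, by rw [Set.mem_preimage, hf'.fderiv]; exact ⟨_, rfl⟩⟩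
  refine ⟨fun x => P.χ (φ.symm (L x)), ⟨L ⁻¹' (φ.target ∩ φ.symm ⁻¹' T), ?_, ?_, ?_, ?_⟩, ?_⟩
  · exact (φ.isOpen_inter_preimage_symm hT).preimage L.continuous
  · refine ⟨φ.map_source hyφ, ?_⟩
    rw [Set.mem_preimage]
    have : φ.symm (L (P.emb y)) = y := φ.left_inv hyφ
    rwa [this]
  · rintro p q x ⟨-, hx1, hx2⟩
    obtain ⟨g', hg'⟩ := hx2.2
    have h1 : ContDiffAt ℝ ∞ φ.symm (L x) := by
      refine φ.contDiffAt_symm (f₀' := g') hx1 ?_ (hf hx2.1)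
      rw [hg']
      exact ((hf hx2.1).differentiableAt (by norm_num)).hasFDerivAt
    have h2 : ContDiffAt ℝ ∞ (fun z => P.χ z p q) (φ.symm (L x)) :=
      (P.smoothMat_χ p q).contDiffAt (P.isOpen_V.mem_nhds hx2.1)
    exact (h2.comp x (h1.comp x L.contDiff.contDiffAt)).contDiffWithinAt
  · rintro x ⟨-, -, hx2⟩
    exact P.χ_sq hx2.1
  · filter_upwards [φ.open_source.mem_nhds hyφ] with z hz
    have : φ.symm (L (P.emb z)) = z := φ.left_inv hz
    rw [this]

/-! The special cases. -/

section Special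

variable {Φ B : (Fin 4 → ℝ) → Matrix (Fin 4 × F) (Fin 4 × F) ℂ}
  {A : Fin 4 → (Fin 4 → ℝ) → Matrix (Fin 4 × F) (Fin 4 × F) ℂ}

theorem θ_eq_zero (hΦ : SmoothMat P.M Φ) (h : P.IsSquareForm Φ A B) (h0 : ∀ x ∈ P.M, Φ x = 0)
    (hx : x ∈ P.M) (μ : Fin 4) : P.θ A μ x = 0 := by
  rw [P.θ_eq hΦ h hx, h0 x hx]; simp

theorem gamma_mul_one_kronecker {Bx : Matrix F F ℂ} (hB : Bx * P.γF = P.γF * Bx) (ν : Fin 4) :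
    (1 : Matrix (Fin 4) (Fin 4) ℂ) ⊗ₖ Bx * P.gamma ν x
      = P.gamma ν x * (1 : Matrix (Fin 4) (Fin 4) ℂ) ⊗ₖ Bx := by
  rw [gamma, ← Matrix.mul_kronecker_mul, ← Matrix.mul_kronecker_mul, hB, one_mul, mul_one]

theorem gamma_mul_one_kronecker_neg {Hx : Matrix F F ℂ} (hH : Hx * P.γF = -(P.γF * Hx))
    (ν : Fin 4) : (1 : Matrix (Fin 4) (Fin 4) ℂ) ⊗ₖ Hx * P.gamma ν x
      = -(P.gamma ν x * (1 : Matrix (Fin 4) (Fin 4) ℂ) ⊗ₖ Hx) := by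
  rw [gamma, ← Matrix.mul_kronecker_mul, ← Matrix.mul_kronecker_mul, hH, one_mul, mul_one]
  ext p q; simp

variable {Bf : Fin 4 → (Fin 4 → ℝ) → Matrix F F ℂ} {H : (Fin 4 → ℝ) → Matrix F F ℂ}

/-- In `{γ^ν, Φ}` the Higgs term cancels because it anticommutes with `γF`, while the gauge term,
commuting with `γF`, leaves `-{γ^ν, γ^l} B_l = 2 B^ν`. -/
theorem θ_model (hΦ : SmoothMat P.M Φ) (h : P.IsSquareForm Φ A B)
    (hB : ∀ x ∈ P.M, ∀ μ, Bf μ x * P.γF = P.γF * Bf μ x)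
    (hH : ∀ x ∈ P.M, H x * P.γF = -(P.γF * H x))
    (hm : ∀ x ∈ P.M, Φ x = P.modelPotential Bf H x) (hx : x ∈ P.M) (μ : Fin 4) :
    P.θ A μ x = (1 : Matrix (Fin 4) (Fin 4) ℂ) ⊗ₖ Bf μ x := by
  set b : Fin 4 → Matrix (Fin 4 × F) (Fin 4 × F) ℂ :=
    fun l => (1 : Matrix (Fin 4) (Fin 4) ℂ) ⊗ₖ Bf l x with hb
  set η := (1 : Matrix (Fin 4) (Fin 4) ℂ) ⊗ₖ H x
  have hΦx : Φ x = -((∑ l, P.gamma l x * b l) + η) := hm x hx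
  have e1 : ∀ ν l, P.gamma l x * b l * P.gamma ν x = P.gamma l x * P.gamma ν x * b l :=
    fun ν l => by rw [mul_assoc, P.gamma_mul_one_kronecker (hB x hx l), mul_assoc]
  have e2 : ∀ ν, η * P.gamma ν x = -(P.gamma ν x * η) := P.gamma_mul_one_kronecker_neg (hH x hx)
  change _ = b μ
  -- From here on only the commutation rules `e1` and `e2` matter, so the tensor products become
  -- opaque atoms.
  clear_value b η
  have h1 : ∀ ν, P.gamma ν x * Φ x + Φ x * P.gamma ν x = (2 : ℝ) • ∑ l, P.gInv x ν l • b l := by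
    intro ν
    calc P.gamma ν x * Φ x + Φ x * P.gamma ν x
        = -∑ l, (P.gamma ν x * P.gamma l x + P.gamma l x * P.gamma ν x) * b l := by
          rw [hΦx]
          simp only [mul_neg, neg_mul, mul_add, add_mul, Finset.mul_sum, Finset.sum_mul,
            Finset.sum_add_distrib, e1, e2, ← mul_assoc]
          abel
      _ = _ := by
          simp only [P.gamma_anticomm, smul_mul_assoc, one_mul, Finset.smul_sum, smul_smul,
            ← Finset.sum_neg_distrib, ← neg_smul, neg_mul, neg_neg]
  have h2 : ∀ l, ∑ ν, P.g x μ ν * P.gInv x ν l = if μ = l then 1 else 0 := fun l => by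
    have := congrFun (congrFun (P.g_mul_gInv hx) μ) l
    rwa [Matrix.mul_apply, Matrix.one_apply] at this
  have h3 : ∑ ν, P.g x μ ν • ∑ l, P.gInv x ν l • b l = b μ := by
    simp only [Finset.smul_sum, smul_smul]
    rw [Finset.sum_comm]
    simp only [← Finset.sum_smul, h2, ite_smul, one_smul, zero_smul, Finset.sum_ite_eq,
      Finset.mem_univ, if_true]
  rw [P.θ_eq hΦ h hx]
  simp only [h1, smul_comm (P.g x μ _) (2 : ℝ), ← Finset.smul_sum, h3]
  module

theorem robin_pure (hΦ : SmoothMat P.M Φ) (h : P.IsSquareForm Φ A B) (h0 : ∀ x ∈ P.M, Φ x = 0)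
    (hy : y ∈ P.V) : P.robin A Φ y = (-(P.trK y / 2)) • P.projP y ∧
      P.robin A (P.primedPotential A Φ) y = (-(P.trK y / 2)) • P.projP y := by
  have hx := P.emb_mem_M hy
  have hθ := fun μ => P.θ_eq_zero hΦ h h0 hx μ
  have ht : ∀ a, P.tangentialPart (P.θ A) a y * P.χ y = P.χ y * P.tangentialPart (P.θ A) a y :=
    fun a => by simp [tangentialPart, hθ]
  constructor
  · exact P.robin_eq hy ht (by simp [h0 _ hx])
  · exact P.robin_eq hy ht (by simp [primedPotential, h0 _ hx, hθ])

/-- The Higgs term commutes with `χ`. With `B_n = 0` the gauge term contains only tangential gamma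
matrices, so it commutes with `χ` too, and `γ_n` makes both products anticommute. In `Φ'` the gauge
term has been absorbed into `θ`, leaving only the Higgs term. -/
theorem robin_model (hΦ : SmoothMat P.M Φ) (h : P.IsSquareForm Φ A B)
    (hB : ∀ x ∈ P.M, ∀ μ, Bf μ x * P.γF = P.γF * Bf μ x)
    (hH : ∀ x ∈ P.M, H x * P.γF = -(P.γF * H x))
    (hm : ∀ x ∈ P.M, Φ x = P.modelPotential Bf H x)
    (hn : ∀ y ∈ P.V, ∑ μ, P.normal μ y • Bf μ (P.emb y) = 0)
    (hy : y ∈ P.V) : P.robin A Φ y = (-(P.trK y / 2)) • P.projP y ∧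
      P.robin A (P.primedPotential A Φ) y = (-(P.trK y / 2)) • P.projP y := by
  have hx := P.emb_mem_M hy
  have hθ := fun μ => P.θ_model hΦ h hB hH hm hx μ
  set b : Fin 4 → Matrix (Fin 4 × F) (Fin 4 × F) ℂ :=
    fun l => (1 : Matrix (Fin 4) (Fin 4) ℂ) ⊗ₖ Bf l (P.emb y) with hb
  set η := (1 : Matrix (Fin 4) (Fin 4) ℂ) ⊗ₖ H (P.emb y) with hη
  have hbχ : ∀ l, P.χ y * b l = b l * P.χ y := fun l => P.χ_mul_one_kronecker _
  have hηχ : P.χ y * η = η * P.χ y := P.χ_mul_one_kronecker _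
  have hNS : P.gammaN y * P.χ y = -(P.χ y * P.gammaN y) := by rw [P.χ_mul_gammaN hy, neg_neg]
  have ht : ∀ a, P.tangentialPart (P.θ A) a y * P.χ y = P.χ y * P.tangentialPart (P.θ A) a y :=
    fun a => by
      simp only [tangentialPart, hθ, Finset.sum_mul, Finset.mul_sum, smul_mul_assoc, mul_smul_comm]
      exact Finset.sum_congr rfl fun l _ => by rw [← hbχ]
  have hηN : P.gammaN y * η * P.χ y = -(P.χ y * (P.gammaN y * η)) := by
    rw [mul_assoc, ← hηχ, ← mul_assoc, hNS, neg_mul, mul_assoc]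
  have hΦx : Φ (P.emb y) = -((∑ l, P.gamma l (P.emb y) * b l) + η) := hm _ hx
  have hbn : ∑ l, P.normal l y • b l = 0 := by
    have : ∑ l, P.normal l y • b l
        = (1 : Matrix (Fin 4) (Fin 4) ℂ) ⊗ₖ ∑ l, P.normal l y • Bf l (P.emb y) := by
      ext p q
      simp only [hb, Matrix.sum_apply, Matrix.smul_apply, Matrix.kroneckerMap_apply,
        Finset.mul_sum, mul_smul_comm]
    rw [this, hn y hy, Matrix.kronecker_zero]
  have hγb : ∑ l, P.gamma l (P.emb y) * b l
      = ∑ a, P.gammaT a y * ∑ l, P.tangent a l y • b l := by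
    have : ∑ l, P.gamma l (P.emb y) * b l = (∑ a, P.gammaT a y * ∑ l, P.tangent a l y • b l)
        + P.gammaN y * ∑ l, P.normal l y • b l := by
      simp only [P.gamma_decomp hy, add_mul, Finset.sum_mul, Finset.mul_sum, smul_mul_assoc,
        mul_smul_comm, Finset.sum_add_distrib]
      rw [Finset.sum_comm]
    rw [this, hbn, mul_zero, add_zero]
  constructor
  · refine P.robin_eq hy ht ?_
    have h1 : P.gammaN y * (∑ a, P.gammaT a y * ∑ l, P.tangent a l y • b l) * P.χ y
        = -(P.χ y * (P.gammaN y * ∑ a, P.gammaT a y * ∑ l, P.tangent a l y • b l)) := by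
      have h2 : (∑ a, P.gammaT a y * ∑ l, P.tangent a l y • b l) * P.χ y
          = P.χ y * ∑ a, P.gammaT a y * ∑ l, P.tangent a l y • b l := by
        simp only [Finset.sum_mul, Finset.mul_sum, smul_mul_assoc, mul_smul_comm]
        refine Finset.sum_congr rfl fun a _ => Finset.sum_congr rfl fun l _ => ?_
        rw [mul_assoc, ← hbχ, ← mul_assoc, ← P.χ_mul_gammaT hy, mul_assoc]
      rw [mul_assoc, h2, ← mul_assoc, hNS, neg_mul, mul_assoc]
    rw [hΦx, hγb, mul_neg, neg_mul, mul_neg, neg_neg, mul_add, add_mul, mul_add, h1, hηN]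
    abel
  · refine P.robin_eq hy ht ?_
    have : P.primedPotential A Φ (P.emb y) = -η := by
      rw [primedPotential, hΦx]
      simp only [hθ]
      change -(∑ l, P.gamma l (P.emb y) * b l + η) + ∑ l, P.gamma l (P.emb y) * b l = -η
      abel
    rw [this, mul_neg, neg_mul, hηN, mul_neg]

end Special

end DiracPatch

end

end DiracBoundary

theorem mainTheorem3 {F : Type*} [Fintype F] [DecidableEq F] (P : DiracBoundary.DiracPatch F)
    (Φ : (Fin 4 → ℝ) → Matrix (Fin 4 × F) (Fin 4 × F) ℂ) (hΦ : DiracBoundary.SmoothMat P.M Φ) :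
    -- the form of `D²`, with unique coefficients, and the splitting of the fibre at the boundary
    (∃ A B, (∀ μ, DiracBoundary.SmoothMat P.M (A μ)) ∧ DiracBoundary.SmoothMat P.M B ∧
      P.IsSquareForm Φ A B) ∧
    (∀ A B A' B', P.IsSquareForm Φ A B → P.IsSquareForm Φ A' B' →
      ∀ x ∈ P.M, (∀ μ, A μ x = A' μ x) ∧ B x = B' x) ∧
    (∀ y ∈ P.V, P.χ y * P.χ y = 1 ∧ ∃ X, P.IsExtensionAt y X) ∧
    ∀ A B, P.IsSquareForm Φ A B →
      -- `D = γ^μ ∇'_μ - Φ'`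
      (∀ Ψ, P.SmoothSpinor Ψ → ∀ x ∈ P.M,
        P.dirac Φ Ψ x = P.diracOp (P.squareConn A) (P.primedPotential A Φ) Ψ x) ∧
      -- `∇'_a χ = K_{ab} χ γ^n γ^b + [θ_a, χ]`
      (∀ y ∈ P.V, ∀ a, P.covχ A a y =
        (∑ b, P.K a b y • (P.χ y * P.gammaN y * P.gammaT b y))
          + (P.tangentialPart (P.θ A) a y * P.χ y - P.χ y * P.tangentialPart (P.θ A) a y)) ∧
      -- the induced boundary condition of `D²`
      (∀ X : (Fin 3 → ℝ) → (Fin 4 → ℝ) → Matrix (Fin 4 × F) (Fin 4 × F) ℂ,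
        (∀ y ∈ P.V, P.IsExtensionAt y (X y)) → ∀ Ψ, P.SmoothSpinor Ψ →
        (P.SquareBC Φ Ψ ↔
          ∀ y ∈ P.V, P.mixedOp A (P.robin A (P.primedPotential A Φ)) (X y) Ψ y = 0)) ∧
      -- pure gravity
      ((∀ x ∈ P.M, Φ x = 0) →
        (∀ x ∈ P.M, ∀ μ, P.θ A μ x = 0) ∧
        ∀ y ∈ P.V,
          P.robin A Φ y = (-(P.trK y / 2)) • P.projP y ∧
          P.robin A (P.primedPotential A Φ) y = (-(P.trK y / 2)) • P.projP y) ∧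
      -- gauge fields `B_μ` with `B_n = 0` on the boundary, and a Higgs field `H`
      (∀ (Bf : Fin 4 → (Fin 4 → ℝ) → Matrix F F ℂ) (H : (Fin 4 → ℝ) → Matrix F F ℂ),
        (∀ x ∈ P.M, ∀ μ, Bf μ x * P.γF = P.γF * Bf μ x) →
        (∀ x ∈ P.M, H x * P.γF = -(P.γF * H x)) →
        (∀ x ∈ P.M, Φ x = P.modelPotential Bf H x) →
        (∀ y ∈ P.V, ∑ μ, P.normal μ y • Bf μ (P.emb y) = 0) →
        (∀ x ∈ P.M, ∀ μ, P.θ A μ x = (1 : Matrix (Fin 4) (Fin 4) ℂ) ⊗ₖ Bf μ x) ∧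
        ∀ y ∈ P.V,
          P.robin A Φ y = (-(P.trK y / 2)) • P.projP y ∧
          P.robin A (P.primedPotential A Φ) y = (-(P.trK y / 2)) • P.projP y) := by
  exact ⟨⟨P.squareCoeffOne Φ, P.squareCoeffZero Φ, P.smoothMat_squareCoeffOne Φ hΦ,
      P.smoothMat_squareCoeffZero Φ hΦ, P.isSquareForm_coeff Φ hΦ⟩,
    fun _ _ _ _ h h' _ hx => P.squareForm_unique Φ h h' hx,
    fun _ hy => ⟨P.χ_sq hy, P.exists_extension hy⟩,
    fun A _ h => ⟨fun Ψ _ x _ => P.dirac_eq_primed A Φ Ψ x,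
      fun _ hy a => P.covχ_eq A hy a,
      fun _ hX _ hΨ => P.squareBC_iff hX hΨ,
      fun h0 => ⟨fun _ hx μ => P.θ_eq_zero hΦ h h0 hx μ, fun _ hy => P.robin_pure hΦ h h0 hy⟩,
      fun _ _ hB hH hm hn => ⟨fun _ hx μ => P.θ_model hΦ h hB hH hm hx μ,
        fun _ hy => P.robin_model hΦ h hB hH hm hn hy⟩⟩⟩
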